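/- Let $N\ge 1$, $R>0$, $\lambda_0>0$, $\varepsilon_{\rm th}>0$, and let an agent be at $p\in\mathbb R^2$. Let $N$ anchors $A_1,\dots,A_N$ be independently and uniformly distributed in the communication region $\{x\in\mathbb R^2:\|x-p\|\le R\}$. For $q\in\mathbb R^2$ let $\theta_n(q)$ be the angle of the vector from $A_n$ to $q$, $u_n(q)=[\cos\theta_n(q),\ \sin\theta_n(q)]^{\mathsf T}$, $J_e(q)=\sum_{n=1}^N\lambda_0\,u_n(q)u_n(q)^{\mathsf T}$, and let the squared position error bound (SPEB) be $\mathcal P(q)=\operatorname{tr}\big(J_e(q)^{-1}\big)$, with $\mathcal P(q)=+\infty$ if $J_e(q)$ is singular. Suppose $N^2\ge 4N/(\lambda_0\varepsilon_{\rm th})$ and put $U=\sqrt{N^2-4N/(\lambda_0\varepsilon_{\rm th})}$. Let $J_0,J_1$ be the Bessel functions of the first kind of orders $0$ and $1$. Then the improper integral $\int_0^\infty J_1(Ur)\,J_0(r)^N\,dr=\lim_{T\to\infty}\int_0^T J_1(Ur)\,J_0(r)^N\,dr$ converges, and the localization outage probability, when all $N$ anchors are used, is exactly $$\mathcal O(\varepsilon_{\rm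 th})=\mathbb P\{\mathcal P(p)>\varepsilon_{\rm th}\}=1-U\int_0^\infty J_1(Ur)\,J_0(r)^N\,dr .$$ Moreover, the worst-case outage probability over a small uncertainty region has the same value in the limit: for every $\delta>0$ there is $\rho>0$ such that for every disc $\mathscr A=\{x:\|x-p^*\|\le \varrho\}$ with $\varrho\le\rho$ and $p\in\mathscr A$, the probability $\mathbb P\{\sup_{q\in\mathscr A}\mathcal P(q)>\varepsilon_{\rm th}\}$ differs from $1-U\int_0^\infty J_1(Ur)\,J_0(r)^N\,dr$ by less than $\delta$. In particular the two are equal if $\mathscr A=\{p\}$. -/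

import Mathlib

open MeasureTheory Filter Topology

noncomputable section

namespace Localization

/-- The Bessel function of the first kind of integer order `n`, by Bessel's integral
`J_n(x) = (1/π) ∫_0^π cos (n τ - x sin τ) dτ`. -/
def besselJ (n : ℕ) (x : ℝ) : ℝ :=
  (1 / Real.pi) * ∫ τ in (0 : ℝ)..Real.pi, Real.cos (n * τ - x * Real.sin τ)

/-- The angle `θ` from an anchor at `a` to an agent at `p`. The plane `ℝ²` is identified with `ℂ`,
whose norm is the Euclidean norm and whose volume is Lebesgue measure. -/
def angle (a p : ℂ) : ℝ := Complex.arg (p - a)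

/-- The unit vector `u = [cos θ, sin θ]ᵀ` for the angle `θ` from the anchor `a` to the agent `p`. -/
def dirVec (a p : ℂ) : Fin 2 → ℝ := ![Real.cos (angle a p), Real.sin (angle a p)]

/-- The equivalent Fisher information matrix `∑ₙ λₙ uₙ uₙᵀ` of an agent at `p` that ranges with all
the anchors `a₁, …, a_N`. -/
def efim {N : ℕ} (lam : Fin N → ℝ) (a : Fin N → ℂ) (p : ℂ) : Matrix (Fin 2) (Fin 2) ℝ :=
  ∑ n, lam n • Matrix.vecMulVec (dirVec (a n) p) (dirVec (a n) p)

open Classical in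
/-- The squared position error bound `tr (J⁻¹)`; it is `+∞` if `J` is singular. -/
def speb {N : ℕ} (lam : Fin N → ℝ) (a : Fin N → ℂ) (p : ℂ) : EReal :=
  if IsUnit (efim lam a p).det then (((efim lam a p)⁻¹.trace : ℝ) : EReal) else ⊤

/-- The worst-case SPEB of the agent within the uncertainty region of centre `pstar` and
radius `r`. -/
def worstSpeb {N : ℕ} (lam : Fin N → ℝ) (a : Fin N → ℂ) (pstar : ℂ) (r : ℝ) : EReal :=
  ⨆ q ∈ Metric.closedBall pstar r, speb lam a q

/-- The law of `N` anchors that are independently and uniformly distributed in the communication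
region, the closed disc of centre `p` and radius `R`. -/
def anchorLaw (N : ℕ) (p : ℂ) (R : ℝ) : Measure (Fin N → ℂ) :=
  Measure.pi fun _ => ProbabilityTheory.cond volume (Metric.closedBall p R)

/-- The probability that the SPEB at the position `p` of the agent exceeds `eps`, when all `N`
anchors in the communication region take part with common ranging intensity `lam0`. -/
def outageAt (N : ℕ) (lam0 eps R : ℝ) (p : ℂ) : ℝ :=
  (anchorLaw N p R).real {a | (eps : EReal) < speb (fun _ => lam0) a p}

/-- The probability that the worst-case SPEB over the uncertainty region of centre `pstar` and
radius `r` exceeds `eps`, for an agent whose communication region is centred at `p`. -/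
def worstOutage (N : ℕ) (lam0 eps R : ℝ) (p pstar : ℂ) (r : ℝ) : ℝ :=
  (anchorLaw N p R).real {a | (eps : EReal) < worstSpeb (fun _ => lam0) a pstar r}

end Localization

end

noncomputable section

namespace Localization

/-! For a symmetric 2×2 matrix, `4 det = tr² - (J₁₁ - J₂₂)² - (2 J₁₂)²`. The information matrix has
trace `lam0 * N`, and its other two terms are `lam0` times the real and imaginary parts of `S = ∑
exp (2iθₙ)`. Hence the SPEB exceeds `eps` exactly when `‖S‖ > U` (`lt_speb_iff`). By rotational
symmetry of the disc about `p`, the doubled angles at `p` are uniform and independent, so `S` is a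
planar random walk with `N` unit steps (`map_anchorLaw`).

It remains to prove Kluyver's formula. Averaging over directions gives `E J₀(r‖S‖) = J₀(r)^N`. By
Fubini, the truncated integral is then the expectation of `weberIntegral (U * T) (‖S‖ / U)`. As `T →
∞` this integrand tends to 1 where `‖S‖ < U` and to 0 where `‖S‖ > U`. It is bounded uniformly
(`abs_weberIntegral_le`), so dominated convergence applies once `‖S‖ = U` is known to be null
(`stepLaw_norm_sum_eq_of_lt`).

For a small region, `S` moves little unless an anchor is close to `p`. The worst-case event lies
between the outage event and a family of sets that shrinks to it up to null sets; continuity from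
above concludes. -/

/-! ### Bessel functions of orders 0 and 1: derivatives and decay. -/

lemma besselJ_zero_eq (x : ℝ) :
    besselJ 0 x = (1 / Real.pi) * ∫ τ in (0 : ℝ)..Real.pi, Real.cos (x * Real.sin τ) := by
  unfold besselJ
  congr 1
  refine intervalIntegral.integral_congr fun τ _ => ?_
  simp

/-- The integrand is odd under `τ ↦ π - τ`. -/
lemma integral_cos_mul_cos_mul_sin (x : ℝ) :
    ∫ τ in (0 : ℝ)..Real.pi, Real.cos τ * Real.cos (x * Real.sin τ) = 0 := by
  have h := intervalIntegral.integral_comp_sub_left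
    (fun τ => Real.cos τ * Real.cos (x * Real.sin τ)) Real.pi (a := 0) (b := Real.pi)
  simp only [Real.cos_pi_sub, Real.sin_pi_sub, sub_self, sub_zero, neg_mul,
    intervalIntegral.integral_neg] at h
  linarith

lemma besselJ_one_eq (x : ℝ) :
    besselJ 1 x =
      (1 / Real.pi) * ∫ τ in (0 : ℝ)..Real.pi, Real.sin τ * Real.sin (x * Real.sin τ) := by
  unfold besselJ
  congr 1
  have h : ∀ τ : ℝ, Real.cos ((1 : ℕ) * τ - x * Real.sin τ) =
      Real.cos τ * Real.cos (x * Real.sin τ) + Real.sin τ * Real.sin (x * Real.sin τ) := by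
    intro τ
    rw [Nat.cast_one, one_mul, Real.cos_sub]
  simp_rw [h]
  rw [intervalIntegral.integral_add, integral_cos_mul_cos_mul_sin, zero_add]
  all_goals exact Continuous.intervalIntegrable (by fun_prop) _ _

/-- The derivative of the Bessel function of order one. -/
def besselJOneDeriv (x : ℝ) : ℝ :=
  (1 / Real.pi) * ∫ τ in (0 : ℝ)..Real.pi, Real.sin τ ^ 2 * Real.cos (x * Real.sin τ)

lemma hasDerivAt_integral_of_continuous_of_bounded {F F' : ℝ → ℝ → ℝ} {a b C : ℝ} (x : ℝ)
    (hF : ∀ x, Continuous (F x)) (hF' : Continuous (F' x))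
    (hd : ∀ t ∈ Set.uIoc a b, ∀ x, HasDerivAt (fun x => F x t) (F' x t) x)
    (hb : ∀ t ∈ Set.uIoc a b, ∀ x, |F' x t| ≤ C) :
    HasDerivAt (fun x => ∫ t in a..b, F x t) (∫ t in a..b, F' x t) x := by
  refine (intervalIntegral.hasDerivAt_integral_of_dominated_loc_of_deriv_le
    (bound := fun _ => C) (F' := F') (s := Set.univ) Filter.univ_mem ?_ ?_ ?_ ?_ ?_ ?_).2
  · exact Eventually.of_forall fun y => (hF y).aestronglyMeasurable
  · exact (hF x).intervalIntegrable _ _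
  · exact hF'.aestronglyMeasurable
  · exact Eventually.of_forall fun t ht y _ => by simpa using hb t ht y
  · exact intervalIntegrable_const
  · exact Eventually.of_forall fun t ht y _ => hd t ht y

lemma hasDerivAt_besselJ_zero (x : ℝ) : HasDerivAt (besselJ 0) (-besselJ 1 x) x := by
  have h := hasDerivAt_integral_of_continuous_of_bounded
    (F := fun x τ => Real.cos (x * Real.sin τ))
    (F' := fun x τ => -(Real.sin τ * Real.sin (x * Real.sin τ))) (a := 0) (b := Real.pi) (C := 1) x
    (fun x => by fun_prop) (by fun_prop)
    (fun t _ x => by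
      exact ((hasDerivAt_id' x).mul_const (Real.sin t)).cos.congr_deriv (by ring))
    (fun t _ x => by
      rw [abs_neg, abs_mul]
      exact mul_le_one₀ (Real.abs_sin_le_one _) (abs_nonneg _) (Real.abs_sin_le_one _))
  rw [show besselJ 0 = fun x => _ from funext besselJ_zero_eq, besselJ_one_eq]
  refine (h.const_mul (1 / Real.pi)).congr_deriv ?_
  rw [intervalIntegral.integral_neg, mul_neg]

lemma hasDerivAt_besselJ_one (x : ℝ) : HasDerivAt (besselJ 1) (besselJOneDeriv x) x := by
  have h := hasDerivAt_integral_of_continuous_of_bounded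
    (F := fun x τ => Real.sin τ * Real.sin (x * Real.sin τ))
    (F' := fun x τ => Real.sin τ ^ 2 * Real.cos (x * Real.sin τ)) (a := 0) (b := Real.pi)
    (C := 1) x
    (fun x => by fun_prop) (by fun_prop)
    (fun t _ x => by
      exact (((hasDerivAt_id' x).mul_const (Real.sin t)).sin.const_mul (Real.sin t)).congr_deriv
        (by ring))
    (fun t _ x => by
      rw [abs_mul, abs_of_nonneg (sq_nonneg _)]
      exact mul_le_one₀ (Real.sin_sq_le_one _) (abs_nonneg _) (Real.abs_cos_le_one _))
  rw [show besselJ 1 = fun x => _ from funext besselJ_one_eq]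
  exact h.const_mul (1 / Real.pi)

/-- The recurrence `x J₁'(x) + J₁(x) = x J₀(x)`. -/
lemma mul_besselJOneDeriv_add (x : ℝ) :
    x * besselJOneDeriv x + besselJ 1 x = x * besselJ 0 x := by
  have hI : ∫ τ in (0 : ℝ)..Real.pi, (-Real.sin τ * Real.sin (x * Real.sin τ) +
      Real.cos τ * (Real.cos (x * Real.sin τ) * (x * Real.cos τ))) = 0 := by
    rw [intervalIntegral.integral_eq_sub_of_hasDerivAt
      (f := fun τ => Real.cos τ * Real.sin (x * Real.sin τ))]
    · simp
    · intro τ _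
      exact (Real.hasDerivAt_cos τ).mul (((Real.hasDerivAt_sin τ).const_mul x).sin)
    · exact Continuous.intervalIntegrable (by fun_prop) _ _
  have hs : ∫ τ in (0 : ℝ)..Real.pi, (-Real.sin τ * Real.sin (x * Real.sin τ) +
      Real.cos τ * (Real.cos (x * Real.sin τ) * (x * Real.cos τ))) =
      x * (∫ τ in (0 : ℝ)..Real.pi, Real.cos (x * Real.sin τ)) -
      x * (∫ τ in (0 : ℝ)..Real.pi, Real.sin τ ^ 2 * Real.cos (x * Real.sin τ)) -
      ∫ τ in (0 : ℝ)..Real.pi, Real.sin τ * Real.sin (x * Real.sin τ) := by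
    rw [← intervalIntegral.integral_const_mul, ← intervalIntegral.integral_const_mul,
      ← intervalIntegral.integral_sub, ← intervalIntegral.integral_sub]
    · refine intervalIntegral.integral_congr fun τ _ => ?_
      have := Real.sin_sq_add_cos_sq τ
      linear_combination (x * Real.cos (x * Real.sin τ)) * this
    all_goals exact Continuous.intervalIntegrable (by fun_prop) _ _
  rw [hI] at hs
  rw [besselJOneDeriv, besselJ_one_eq, besselJ_zero_eq]
  linear_combination (1 / Real.pi) * hs

lemma continuous_besselJ_zero : Continuous (besselJ 0) :=
  continuous_iff_continuousAt.2 fun x => (hasDerivAt_besselJ_zero x).continuousAt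

lemma continuous_besselJ_one : Continuous (besselJ 1) :=
  continuous_iff_continuousAt.2 fun x => (hasDerivAt_besselJ_one x).continuousAt

lemma abs_besselJ_le_one (n : ℕ) (x : ℝ) : |besselJ n x| ≤ 1 := by
  have h := intervalIntegral.norm_integral_le_of_norm_le_const (a := 0) (b := Real.pi) (C := 1)
    (f := fun τ => Real.cos (n * τ - x * Real.sin τ)) (fun t _ => Real.abs_cos_le_one _)
  rw [sub_zero, abs_of_pos Real.pi_pos, one_mul, Real.norm_eq_abs] at h
  rw [besselJ, abs_mul, abs_of_pos (by positivity), one_div, inv_mul_le_iff₀ Real.pi_pos, mul_one]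
  exact h

lemma besselJ_zero_zero : besselJ 0 0 = 1 := by
  rw [besselJ_zero_eq]; simp [Real.pi_ne_zero]

lemma besselJ_one_zero : besselJ 1 0 = 0 := by
  rw [besselJ_one_eq]; simp

lemma sq_besselJ_zero_add_sq_besselJ_one_le {x : ℝ} (hx : 0 < x) :
    besselJ 0 x ^ 2 + besselJ 1 x ^ 2 ≤ 7 / x := by
  have b0 := abs_le.1 (abs_besselJ_le_one 0 x)
  have b1 := abs_le.1 (abs_besselJ_le_one 1 x)
  rw [le_div_iff₀ hx]
  rcases le_total x 1 with h1 | h1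
  · have : besselJ 0 x ^ 2 + besselJ 1 x ^ 2 ≤ 2 := by nlinarith
    nlinarith [sq_nonneg (besselJ 0 x), sq_nonneg (besselJ 1 x)]
  -- A corrected energy: the derivative of `x(J₀² + J₁²)` has no fixed sign, and the two added terms
  -- turn the total derivative into `-J₀²/(2x²)`.
  · let E : ℝ → ℝ := fun x => x * (besselJ 0 x ^ 2 + besselJ 1 x ^ 2) -
      besselJ 0 x * besselJ 1 x + besselJ 0 x ^ 2 / (2 * x)
    have hE : ∀ y : ℝ, 0 < y → HasDerivAt E (-(besselJ 0 y ^ 2 / (2 * y ^ 2))) y := by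
      intro y hy
      have h0 := hasDerivAt_besselJ_zero y
      have h1 := hasDerivAt_besselJ_one y
      have hr := mul_besselJOneDeriv_add y
      have hD : besselJOneDeriv y = besselJ 0 y - besselJ 1 y / y := by
        field_simp; linarith
      have := (((hasDerivAt_id' y).mul ((h0.pow 2).add (h1.pow 2))).sub (h0.mul h1)).add
        ((h0.pow 2).div ((hasDerivAt_id' y).const_mul 2) (by positivity))
      refine this.congr_deriv ?_
      simp only [hD, Pi.add_apply, Pi.pow_apply]
      field_simp
      ring
    have hanti : AntitoneOn E (Set.Ici 1) := by
      refine antitoneOn_of_hasDerivWithinAt_nonpos (convex_Ici 1)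
        (fun y hy => (hE y (by linarith [Set.mem_Ici.1 hy])).continuousAt.continuousWithinAt)
        (fun y hy => (hE y ?_).hasDerivWithinAt) (fun y hy => ?_)
      · rw [interior_Ici] at hy; linarith [Set.mem_Ioi.1 hy]
      · have : 0 ≤ besselJ 0 y ^ 2 / (2 * y ^ 2) := by positivity
        linarith
    have hle : E x ≤ E 1 := hanti (Set.mem_Ici.2 le_rfl) (Set.mem_Ici.2 h1) h1
    have hp : 0 ≤ besselJ 0 x ^ 2 / (2 * x) := by positivity
    have c0 := abs_le.1 (abs_besselJ_le_one 0 1)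
    have c1 := abs_le.1 (abs_besselJ_le_one 1 1)
    have hE1 : E 1 ≤ 7 / 2 := by
      simp only [E]
      nlinarith
    simp only [E] at hle hE1
    -- Since `J₀J₁ ≤ (J₀² + J₁²)/2` and `x ≥ 1`, the energy is at least `(x/2)(J₀² + J₁²)`.
    nlinarith [sq_nonneg (besselJ 0 x - besselJ 1 x), sq_nonneg (besselJ 0 x),
      sq_nonneg (besselJ 1 x)]

lemma abs_besselJ_mul_besselJ_le {i j : Fin 2} {x y : ℝ} (hx : 0 < x) (hxy : x ≤ y) :
    |besselJ i y * besselJ j x| ≤ 7 / x := by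
  have hX := sq_besselJ_zero_add_sq_besselJ_one_le hx
  have hY := (sq_besselJ_zero_add_sq_besselJ_one_le (hx.trans_le hxy)).trans
    (div_le_div_of_nonneg_left (by norm_num) hx hxy)
  have h : ∀ (i : Fin 2) (z : ℝ), besselJ i z ^ 2 ≤ besselJ 0 z ^ 2 + besselJ 1 z ^ 2 := by
    intro i z
    fin_cases i
    · simpa using sq_nonneg _
    · simpa using sq_nonneg _
  have hi := h i y
  have hj := h j x
  rw [abs_le]
  constructor
  · nlinarith [sq_nonneg (besselJ i y + besselJ j x)]
  · nlinarith [sq_nonneg (besselJ i y - besselJ j x)]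

lemma tendsto_besselJ_atTop (i : Fin 2) : Tendsto (besselJ i) atTop (𝓝 0) := by
  have h : Tendsto (fun x => besselJ i x ^ 2) atTop (𝓝 0) := by
    refine tendsto_of_tendsto_of_tendsto_of_le_of_le' tendsto_const_nhds
      (tendsto_const_nhds.div_atTop tendsto_id : Tendsto (fun x : ℝ => 7 / x) atTop (𝓝 0))
      (Eventually.of_forall fun x => sq_nonneg _) ?_
    filter_upwards [eventually_gt_atTop 0] with x hx
    have := abs_besselJ_mul_besselJ_le (i := i) (j := i) hx le_rfl
    rw [← sq, abs_of_nonneg (sq_nonneg _)] at this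
    exact this
  have h2 := h.sqrt
  simp only [Real.sqrt_sq_eq_abs, Real.sqrt_zero] at h2
  exact (tendsto_zero_iff_abs_tendsto_zero _).2 h2

/-! ### The discontinuous integral of Weber and Schafheitlin. -/

/-- The truncated discontinuous integral of Weber and Schafheitlin. -/
def weberIntegral (T s : ℝ) : ℝ := ∫ x in (0 : ℝ)..T, besselJ 1 x * besselJ 0 (s * x)

/-- The truncated integral of Lommel for the Bessel function of order one. -/
def lommelIntegral (T s : ℝ) : ℝ := ∫ x in (0 : ℝ)..T, x * besselJ 1 x * besselJ 1 (s * x)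

lemma hasDerivAt_mul_besselJ_one (s x : ℝ) :
    HasDerivAt (fun x => x * besselJ 1 (s * x)) (s * x * besselJ 0 (s * x)) x := by
  have h := (hasDerivAt_besselJ_one (s * x)).comp x ((hasDerivAt_id' x).const_mul s)
  refine ((hasDerivAt_id' x).mul h).congr_deriv ?_
  have := mul_besselJOneDeriv_add (s * x)
  simp only [Function.comp]
  linear_combination this

lemma hasDerivAt_besselJ_zero_mul (s x : ℝ) :
    HasDerivAt (fun x => besselJ 0 (s * x)) (-(s * besselJ 1 (s * x))) x :=
  ((hasDerivAt_besselJ_zero (s * x)).comp x ((hasDerivAt_id' x).const_mul s)).congr_deriv (by ring)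

lemma continuous_besselJ_zero_comp {α : Type*} [TopologicalSpace α] {f : α → ℝ} (hf : Continuous f) :
    Continuous fun x => besselJ 0 (f x) := continuous_besselJ_zero.comp hf

lemma continuous_besselJ_one_comp {α : Type*} [TopologicalSpace α] {f : α → ℝ} (hf : Continuous f) :
    Continuous fun x => besselJ 1 (f x) := continuous_besselJ_one.comp hf

lemma one_sub_sq_mul_lommelIntegral (T s : ℝ) :
    (1 - s ^ 2) * lommelIntegral T s =
      T * (s * besselJ 1 T * besselJ 0 (s * T) - besselJ 1 (s * T) * besselJ 0 T) := by
  have hd : ∀ x : ℝ, HasDerivAt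
      -- A Wronskian-type antiderivative; `1 * x` lets the scaled derivative lemmas apply with
      -- factor 1.
      (fun x => s * (x * besselJ 1 (1 * x) * besselJ 0 (s * x)) -
        x * besselJ 1 (s * x) * besselJ 0 (1 * x))
      ((1 - s ^ 2) * (x * besselJ 1 x * besselJ 1 (s * x))) x := by
    intro x
    refine (((hasDerivAt_mul_besselJ_one 1 x).mul
      (hasDerivAt_besselJ_zero_mul s x)).const_mul s |>.sub
      ((hasDerivAt_mul_besselJ_one s x).mul (hasDerivAt_besselJ_zero_mul 1 x))).congr_deriv ?_
    simp only [one_mul]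
    ring
  rw [lommelIntegral, ← intervalIntegral.integral_const_mul,
    intervalIntegral.integral_eq_sub_of_hasDerivAt (fun x _ => hd x)]
  · simp only [one_mul, zero_mul, mul_zero]
    ring
  · refine Continuous.intervalIntegrable ?_ _ _
    have h1 := continuous_besselJ_one
    have h2 := continuous_besselJ_one_comp (continuous_const_mul s)
    fun_prop

lemma hasDerivAt_weberIntegral {T : ℝ} (hT : 0 ≤ T) (s : ℝ) :
    HasDerivAt (weberIntegral T) (-lommelIntegral T s) s := by
  have h1 := continuous_besselJ_one
  rw [lommelIntegral, ← intervalIntegral.integral_neg]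
  refine hasDerivAt_integral_of_continuous_of_bounded
    (F := fun s x => besselJ 1 x * besselJ 0 (s * x))
    (F' := fun s x => -(x * besselJ 1 x * besselJ 1 (s * x))) (C := T) s (fun s => ?_) ?_ ?_ ?_
  · have h2 := continuous_besselJ_zero_comp (continuous_const_mul s)
    fun_prop
  · have h2 := continuous_besselJ_one_comp (continuous_const_mul s)
    fun_prop
  · intro x _ s
    have h := ((hasDerivAt_besselJ_zero (s * x)).comp s
      ((hasDerivAt_id' s).mul_const x)).const_mul (besselJ 1 x)
    exact h.congr_deriv (show _ = -(x * besselJ 1 x * besselJ 1 (s * x)) by ring)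
  · intro x hx s
    rw [Set.uIoc_of_le hT] at hx
    rw [abs_neg, abs_mul, abs_mul, abs_of_pos hx.1]
    have a := abs_besselJ_le_one 1 x
    have b := abs_besselJ_le_one 1 (s * x)
    calc x * |besselJ 1 x| * |besselJ 1 (s * x)| ≤ x * 1 * 1 := by
          have := hx.1
          gcongr
      _ ≤ T := by linarith [hx.2]

lemma weberIntegral_zero (T : ℝ) : weberIntegral T 0 = 1 - besselJ 0 T := by
  rw [weberIntegral, intervalIntegral.integral_eq_sub_of_hasDerivAt (f := fun x => -besselJ 0 x)]
  · rw [besselJ_zero_zero]; ring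
  · intro x _
    refine (hasDerivAt_besselJ_zero x).neg.congr_deriv ?_
    rw [zero_mul, besselJ_zero_zero]; ring
  · simp only [zero_mul]
    exact (continuous_besselJ_one.mul continuous_const).intervalIntegrable _ _

/-- The boundary term in the evaluation of `weberIntegral`. -/
def weberBoundary (T s : ℝ) : ℝ :=
  besselJ 1 T * (s * besselJ 1 (T * s)) + besselJ 0 T * besselJ 0 (T * s)

lemma hasDerivAt_weberBoundary (T s : ℝ) :
    HasDerivAt (weberBoundary T)
      (T * (s * besselJ 1 T * besselJ 0 (s * T) - besselJ 1 (s * T) * besselJ 0 T)) s := by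
  refine (((hasDerivAt_mul_besselJ_one T s).const_mul _).add
    ((hasDerivAt_besselJ_zero_mul T s).const_mul _)).congr_deriv ?_
  rw [mul_comm s T]
  ring

/-- Integration by parts in `s`: `weberBoundary` has derivative `(1 - s²) * lommelIntegral T s`, so
the Lommel integral cancels and only a term that decays in `T` is left. -/
lemma hasDerivAt_weberIntegral_add {T s : ℝ} (hT : 0 ≤ T) (hs : 0 ≤ s) (hs1 : s < 1) :
    HasDerivAt (fun s => weberIntegral T s + weberBoundary T s / (1 - s ^ 2))
      (2 * s * weberBoundary T s / (1 - s ^ 2) ^ 2) s := by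
  have hne : 1 - s ^ 2 ≠ 0 := by nlinarith
  have h : HasDerivAt (fun s : ℝ => 1 - s ^ 2) (-(2 * s)) s :=
    ((hasDerivAt_pow 2 s).const_sub 1).congr_deriv (by simp)
  refine ((hasDerivAt_weberIntegral hT s).add
    ((hasDerivAt_weberBoundary T s).div h hne)).congr_deriv ?_
  rw [← one_sub_sq_mul_lommelIntegral]
  field_simp
  ring

lemma abs_weberBoundary_le {T s : ℝ} (hs : 0 ≤ s) (hs1 : s ≤ 1) :
    |weberBoundary T s| ≤ |besselJ 0 T| + |besselJ 1 T| := by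
  rw [weberBoundary, add_comm |besselJ 0 T|]
  refine (abs_add_le _ _).trans (add_le_add ?_ ?_)
  · rw [abs_mul, abs_mul, abs_of_nonneg hs]
    exact mul_le_of_le_one_right (abs_nonneg _)
      (mul_le_one₀ hs1 (abs_nonneg _) (abs_besselJ_le_one _ _))
  · rw [abs_mul]
    exact mul_le_of_le_one_right (abs_nonneg _) (abs_besselJ_le_one _ _)

/-- Decay of both factors gives the rate `1/T`, at the price of a singularity at `s = 0`. This rate
is what the uniform bound near `s = 1` needs. -/
lemma abs_weberBoundary_le_div {T s : ℝ} (hT : 0 < T) (hs : 0 < s) (hs1 : s ≤ 1) :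
    |weberBoundary T s| ≤ 7 / (T * s) := by
  have hX := sq_besselJ_zero_add_sq_besselJ_one_le (mul_pos hT hs)
  have hY := (sq_besselJ_zero_add_sq_besselJ_one_le hT).trans
    (div_le_div_of_nonneg_left (by norm_num) (mul_pos hT hs) (mul_le_of_le_one_right hT.le hs1))
  have h2 : (s * besselJ 1 (T * s)) ^ 2 ≤ besselJ 1 (T * s) ^ 2 := by
    rw [mul_pow]
    exact mul_le_of_le_one_left (sq_nonneg _) (pow_le_one₀ hs.le hs1)
  rw [weberBoundary, abs_le]
  constructor
  · nlinarith [sq_nonneg (besselJ 1 T + s * besselJ 1 (T * s)),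
      sq_nonneg (besselJ 0 T + besselJ 0 (T * s))]
  · nlinarith [sq_nonneg (besselJ 1 T - s * besselJ 1 (T * s)),
      sq_nonneg (besselJ 0 T - besselJ 0 (T * s))]

lemma weberIntegral_add_weberBoundary_zero (T : ℝ) :
    weberIntegral T 0 + weberBoundary T 0 / (1 - 0 ^ 2) = 1 := by
  simp [weberIntegral_zero, weberBoundary, besselJ_zero_zero]

/-- Mean value inequality on `[0, s]`; in the constant 3, the derivative contributes 2 and the
boundary quotient 1. It yields the limit for fixed `s`, but is too singular at `s = 1` for
domination. -/
lemma abs_weberIntegral_sub_one_le {T s : ℝ} (hT : 0 ≤ T) (hs : 0 ≤ s) (hs1 : s < 1) :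
    |weberIntegral T s - 1| ≤ 3 / (1 - s ^ 2) ^ 2 * (|besselJ 0 T| + |besselJ 1 T|) := by
  set q := |besselJ 0 T| + |besselJ 1 T| with hq
  have hq0 : 0 ≤ q := by positivity
  have hpos : 0 < 1 - s ^ 2 := by nlinarith
  have hW := (convex_Icc (0 : ℝ) s).norm_image_sub_le_of_norm_hasDerivWithin_le
    (C := 2 * q / (1 - s ^ 2) ^ 2)
    (fun σ hσ => (hasDerivAt_weberIntegral_add hT hσ.1 (hσ.2.trans_lt hs1)).hasDerivWithinAt)
    (fun σ hσ => by
      have hb := abs_weberBoundary_le (T := T) hσ.1 (hσ.2.trans hs1.le)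
      have hle : 1 - s ^ 2 ≤ 1 - σ ^ 2 := by nlinarith [hσ.1, hσ.2]
      have := hσ.1
      have := hσ.2
      rw [Real.norm_eq_abs, abs_div, abs_mul, abs_of_nonneg (by positivity : 0 ≤ 2 * σ),
        abs_of_nonneg (by positivity : 0 ≤ (1 - σ ^ 2) ^ 2)]
      gcongr
      linarith)
    (Set.left_mem_Icc.2 hs) (Set.right_mem_Icc.2 hs)
  rw [weberIntegral_add_weberBoundary_zero, Real.norm_eq_abs, Real.norm_eq_abs, sub_zero,
    abs_of_nonneg hs] at hW
  have hB : |weberBoundary T s / (1 - s ^ 2)| ≤ q / (1 - s ^ 2) := by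
    rw [abs_div, abs_of_pos hpos]
    have := abs_weberBoundary_le (T := T) hs hs1.le
    gcongr
  have h1 : q / (1 - s ^ 2) ≤ q / (1 - s ^ 2) ^ 2 := by
    gcongr
    nlinarith [sq_nonneg s]
  have h2 : 2 * q / (1 - s ^ 2) ^ 2 * s ≤ 2 * q / (1 - s ^ 2) ^ 2 :=
    mul_le_of_le_one_right (by positivity) hs1.le
  have h3 : 3 / (1 - s ^ 2) ^ 2 * q = q / (1 - s ^ 2) ^ 2 + 2 * q / (1 - s ^ 2) ^ 2 := by ring
  rw [h3]
  have := abs_le.1 hW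
  have := abs_le.1 hB
  rw [abs_le]
  constructor <;> linarith

lemma abs_weberIntegral_sub_one_le_div {T s : ℝ} (hT : 0 < T) (hs : 1 / 2 ≤ s) (hs1 : s < 1) :
    |weberIntegral T s - 1| ≤ 28 / (T * (1 - s)) := by
  have hs0 : 0 ≤ s := by linarith
  have h1s : 0 < 1 - s := by linarith
  -- An explicit majorant, vanishing at 0, in place of a constant derivative bound: this leaves only
  -- a first-order pole at `s = 1`.
  have hB : ∀ σ ∈ Set.Icc 0 s, HasDerivAt (fun σ : ℝ => 14 / T * ((1 - σ)⁻¹ - 1))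
      (14 / T * (1 / (1 - σ) ^ 2)) σ := by
    intro σ hσ
    have h : HasDerivAt (fun σ : ℝ => 1 - σ) (-1) σ := (hasDerivAt_id' σ).const_sub 1
    refine (((h.inv ?_).sub_const 1).const_mul _).congr_deriv (by simp)
    linarith [hσ.2]
  have hf : ∀ σ ∈ Set.Icc 0 s, HasDerivAt
      (fun σ => weberIntegral T σ + weberBoundary T σ / (1 - σ ^ 2) - 1)
      (2 * σ * weberBoundary T σ / (1 - σ ^ 2) ^ 2) σ := fun σ hσ =>
    (hasDerivAt_weberIntegral_add hT.le hσ.1 (hσ.2.trans_lt hs1)).sub_const 1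
  have hW := image_norm_le_of_norm_deriv_right_le_deriv_boundary' (a := 0) (b := s)
    (fun σ hσ => (hf σ hσ).continuousAt.continuousWithinAt)
    (fun σ hσ => (hf σ ⟨hσ.1, hσ.2.le⟩).hasDerivWithinAt)
    (by rw [weberIntegral_add_weberBoundary_zero]; simp)
    (fun σ hσ => (hB σ hσ).continuousAt.continuousWithinAt)
    (fun σ hσ => (hB σ ⟨hσ.1, hσ.2.le⟩).hasDerivWithinAt)
    (fun σ hσ => by
      have h0 := hσ.1
      have h1 : σ < 1 := hσ.2.trans hs1
      have h2 : 0 < 1 - σ := by linarith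
      rw [Real.norm_eq_abs, abs_div, abs_mul, abs_of_nonneg (by positivity : 0 ≤ 2 * σ),
        abs_of_nonneg (by positivity : 0 ≤ (1 - σ ^ 2) ^ 2)]
      -- The factor `σ` cancels the singularity of the boundary bound at 0.
      have hn : 2 * σ * |weberBoundary T σ| ≤ 14 / T := by
        rcases h0.eq_or_lt with h | h
        · rw [← h]; simp; positivity
        · calc 2 * σ * |weberBoundary T σ| ≤ 2 * σ * (7 / (T * σ)) := by
                gcongr
                exact abs_weberBoundary_le_div hT h h1.le
            _ = 14 / T := by field_simp; norm_num
      calc 2 * σ * |weberBoundary T σ| / (1 - σ ^ 2) ^ 2 ≤ 14 / T / (1 - σ) ^ 2 := by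
            gcongr
            nlinarith
        _ = _ := by ring)
    (Set.right_mem_Icc.2 hs0)
  have hb := abs_weberBoundary_le_div hT (by linarith : 0 < s) hs1.le
  have hp : 0 < T * (1 - s) := by positivity
  have hQ : |weberBoundary T s / (1 - s ^ 2)| ≤ 14 / (T * (1 - s)) := by
    have h2 : 0 < 1 - s ^ 2 := by nlinarith
    rw [abs_div, abs_of_pos h2]
    calc |weberBoundary T s| / (1 - s ^ 2) ≤ 7 / (T * s) / (1 - s) := by
          gcongr
          nlinarith
      _ ≤ 7 / (T * (1 / 2)) / (1 - s) := by gcongr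
      _ = 14 / (T * (1 - s)) := by field_simp; norm_num
  have hE : 14 / T * ((1 - s)⁻¹ - 1) ≤ 14 / (T * (1 - s)) := by
    have : 14 / T * ((1 - s)⁻¹ - 1) = 14 / (T * (1 - s)) - 14 / T := by field_simp
    rw [this]
    have : 0 < 14 / T := by positivity
    linarith
  have h3 : 28 / (T * (1 - s)) = 14 / (T * (1 - s)) + 14 / (T * (1 - s)) := by ring
  rw [Real.norm_eq_abs] at hW
  have := abs_le.1 hW
  have := abs_le.1 hQ
  rw [h3, abs_le]
  constructor <;> linarith

/-- Exchange of the two Bessel functions by partial integration. -/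
lemma weberIntegral_add_weberIntegral_inv (T : ℝ) {s : ℝ} (hs : s ≠ 0) :
    weberIntegral T s + weberIntegral (s * T) s⁻¹ = 1 - besselJ 0 T * besselJ 0 (s * T) := by
  have h1 := continuous_besselJ_one
  have h2 := continuous_besselJ_zero
  have h3 := continuous_besselJ_zero_comp (continuous_const_mul s)
  have h4 := continuous_besselJ_one_comp (continuous_const_mul s)
  have e : weberIntegral (s * T) s⁻¹ =
      ∫ x in (0 : ℝ)..T, s * (besselJ 1 (s * x) * besselJ 0 x) := by
    have := intervalIntegral.integral_comp_mul_left (a := 0) (b := T)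
      (fun x => besselJ 1 x * besselJ 0 (s⁻¹ * x)) hs
    rw [mul_zero, smul_eq_mul] at this
    rw [weberIntegral, intervalIntegral.integral_const_mul]
    simp only [inv_mul_cancel_left₀ hs] at this
    rw [this, mul_inv_cancel_left₀ hs]
  rw [e, weberIntegral, ← intervalIntegral.integral_add]
  · rw [intervalIntegral.integral_eq_sub_of_hasDerivAt
      (f := fun x => -(besselJ 0 x * besselJ 0 (s * x)))]
    · simp [besselJ_zero_zero]; ring
    · intro x _
      exact ((hasDerivAt_besselJ_zero x).mul (hasDerivAt_besselJ_zero_mul s x)).neg.congr_deriv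
        (by ring)
    · exact Continuous.intervalIntegrable (by fun_prop) _ _
  · exact Continuous.intervalIntegrable (by fun_prop) _ _
  · exact Continuous.intervalIntegrable (by fun_prop) _ _

lemma abs_one_sub_besselJ_mul_le (x y : ℝ) : |1 - besselJ 0 x * besselJ 0 y| ≤ 2 := by
  have h : |besselJ 0 x * besselJ 0 y| ≤ 1 := by
    rw [abs_mul]
    exact mul_le_one₀ (abs_besselJ_le_one _ _) (abs_nonneg _) (abs_besselJ_le_one _ _)
  rw [abs_le] at h ⊢
  constructor <;> linarith [h.1, h.2]

/-- At `s = 1` the two integrals in the exchange identity coincide. -/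
lemma abs_weberIntegral_one_le (T : ℝ) : |weberIntegral T 1| ≤ 2 := by
  have h := weberIntegral_add_weberIntegral_inv T one_ne_zero
  have h2 := abs_one_sub_besselJ_mul_le T (1 * T)
  rw [← h, inv_one, one_mul] at h2
  rw [abs_le] at h2 ⊢
  constructor <;> linarith [h2.1, h2.2]

lemma abs_lommelIntegral_le {T s : ℝ} (hT : 0 ≤ T) (hs : 1 / 2 ≤ s) (hs1 : s ≤ 1) :
    |lommelIntegral T s| ≤ 14 * T := by
  have h := intervalIntegral.norm_integral_le_of_norm_le_const (a := 0) (b := T) (C := 14)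
    (f := fun x => x * besselJ 1 x * besselJ 1 (s * x)) (fun x hx => by
      rw [Set.uIoc_of_le hT] at hx
      have hx0 := hx.1
      have := abs_besselJ_mul_besselJ_le (i := 1) (j := 1) (x := s * x) (y := x)
        (by positivity) (mul_le_of_le_one_left hx0.le hs1)
      rw [mul_assoc, Real.norm_eq_abs, abs_mul, abs_of_pos hx0]
      calc x * |besselJ 1 x * besselJ 1 (s * x)| ≤ x * (7 / (s * x)) := by gcongr; exact this
        _ = 7 / s := by field_simp
        _ ≤ 7 / (1 / 2) := by gcongr
        _ = 14 := by norm_num)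
  rwa [sub_zero, abs_of_nonneg hT] at h

/-- Three regimes: `s` away from 1; `s` within `1/T` of 1, compared with the value at 1 through the
derivative bound `14 * T`; and `T(1 - s) ≥ 1`, where the first-order estimate gives `28 + 1`. -/
lemma abs_weberIntegral_le_of_le_one {T s : ℝ} (hT : 0 ≤ T) (hs : 0 ≤ s) (hs1 : s ≤ 1) :
    |weberIntegral T s| ≤ 29 := by
  rcases le_total s (1 / 2) with h | h
  · have h1 := abs_weberIntegral_sub_one_le hT hs (by linarith)
    have h2 : 3 / (1 - s ^ 2) ^ 2 ≤ 3 / (1 - (1 / 2) ^ 2) ^ 2 := by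
      have : s ^ 2 ≤ (1 / 2) ^ 2 := by gcongr
      gcongr 3 / ?_ ^ 2
      linarith
    have h3 := abs_besselJ_le_one 0 T
    have h4 := abs_besselJ_le_one 1 T
    have h5 : 3 / (1 - s ^ 2) ^ 2 * (|besselJ 0 T| + |besselJ 1 T|) ≤
        3 / (1 - (1 / 2) ^ 2) ^ 2 * (1 + 1) := by gcongr
    have h6 := abs_le.1 (h1.trans h5)
    norm_num at h6
    rw [abs_le]
    constructor <;> linarith [h6.1, h6.2]
  · rcases le_total (T * (1 - s)) 1 with h1 | h1
    · have hL := (convex_Icc s (1 : ℝ)).norm_image_sub_le_of_norm_hasDerivWithin_le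
        (C := 14 * T) (fun σ _ => (hasDerivAt_weberIntegral hT σ).hasDerivWithinAt)
        (fun σ hσ => by
          rw [norm_neg]
          exact abs_lommelIntegral_le hT (h.trans hσ.1) hσ.2)
        (Set.left_mem_Icc.2 hs1) (Set.right_mem_Icc.2 hs1)
      rw [Real.norm_eq_abs, Real.norm_eq_abs, abs_of_nonneg (by linarith : 0 ≤ 1 - s)] at hL
      have h2 := abs_le.1 (abs_weberIntegral_one_le T)
      have h3 := abs_le.1 (hL.trans (by linarith : 14 * T * (1 - s) ≤ 14))
      rw [abs_le]
      constructor <;> linarith [h2.1, h2.2, h3.1, h3.2]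
    · have hs1' : s < 1 := by
        by_contra hc
        have : s = 1 := by linarith
        rw [this] at h1
        norm_num at h1
      have hT' : 0 < T := by
        by_contra hc
        have : T = 0 := by linarith
        rw [this] at h1
        norm_num at h1
      have h2 := (abs_weberIntegral_sub_one_le_div hT' h hs1').trans
        (div_le_of_le_mul₀ (by positivity) (by norm_num : (0 : ℝ) ≤ 28) (by linarith))
      have h3 := abs_le.1 h2
      rw [abs_le]
      constructor <;> linarith [h3.1, h3.2]

/-- The exchange identity sends `s > 1` to `s⁻¹` and costs at most 2. -/
lemma abs_weberIntegral_le {T s : ℝ} (hT : 0 ≤ T) (hs : 0 ≤ s) : |weberIntegral T s| ≤ 31 := by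
  rcases le_total s 1 with h | h
  · exact (abs_weberIntegral_le_of_le_one hT hs h).trans (by norm_num)
  · have h1 := weberIntegral_add_weberIntegral_inv T (by linarith : s ≠ 0)
    have h2 := abs_le.1 (abs_one_sub_besselJ_mul_le T (s * T))
    have h3 := abs_le.1 (abs_weberIntegral_le_of_le_one (mul_nonneg hs hT) (inv_nonneg.2 hs)
      (inv_le_one_of_one_le₀ h))
    rw [abs_le]
    constructor <;> linarith [h2.1, h2.2, h3.1, h3.2]

lemma tendsto_weberIntegral_of_lt_one {s : ℝ} (hs : 0 ≤ s) (hs1 : s < 1) :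
    Tendsto (fun T => weberIntegral T s) atTop (𝓝 1) := by
  rw [tendsto_iff_norm_sub_tendsto_zero]
  have h := ((tendsto_besselJ_atTop 0).abs.add (tendsto_besselJ_atTop 1).abs).const_mul
    (3 / (1 - s ^ 2) ^ 2)
  simp only [abs_zero, add_zero, mul_zero] at h
  refine tendsto_of_tendsto_of_tendsto_of_le_of_le' tendsto_const_nhds h
    (Eventually.of_forall fun _ => norm_nonneg _) ?_
  filter_upwards [eventually_ge_atTop 0] with T hT
  exact abs_weberIntegral_sub_one_le hT hs hs1

lemma tendsto_weberIntegral_of_one_lt {s : ℝ} (hs : 1 < s) :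
    Tendsto (fun T => weberIntegral T s) atTop (𝓝 0) := by
  have hs0 : 0 < s := by linarith
  have hmul : Tendsto (fun T : ℝ => s * T) atTop atTop := tendsto_id.const_mul_atTop hs0
  have h1 := (tendsto_weberIntegral_of_lt_one (inv_nonneg.2 hs0.le)
    (inv_lt_one_of_one_lt₀ hs)).comp hmul
  have h2 := (tendsto_besselJ_atTop 0).mul ((tendsto_besselJ_atTop 0).comp hmul)
  have h3 := (h2.const_sub 1).sub h1
  simp only [mul_zero, sub_zero, sub_self] at h3
  refine h3.congr fun T => ?_
  have := weberIntegral_add_weberIntegral_inv T hs0.ne'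
  simp only [Function.comp]
  exact (eq_sub_of_add_eq this).symm

/-! ### The law of the doubled direction of a uniform anchor. -/

/-- The unit vector with twice the angle `θ`, as a complex number. -/
def doubleAngle (θ : ℝ) : ℂ := Complex.exp (2 * θ * Complex.I)

lemma continuous_doubleAngle : Continuous doubleAngle := by
  unfold doubleAngle; fun_prop

lemma norm_doubleAngle (θ : ℝ) : ‖doubleAngle θ‖ = 1 := by
  have : (2 * θ * Complex.I : ℂ) = ((2 * θ : ℝ) : ℂ) * Complex.I := by push_cast; ring
  rw [doubleAngle, this, Complex.norm_exp_ofReal_mul_I]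

/-- The law of `e^{2iθ}` for an angle `θ` that is uniformly distributed on the circle. -/
def circleLaw : Measure ℂ :=
  ((ENNReal.ofReal (2 * Real.pi))⁻¹ • volume.restrict (Set.Ioo (-Real.pi) Real.pi)).map doubleAngle

/-- Polar coordinates about `p` separate radius and angle. The radial factor `K` need not be
evaluated: total mass 1 fixes it afterwards. -/
lemma exists_lintegral_arg_eq (p : ℂ) (R : ℝ) : ∃ K : ENNReal, ∀ g : ℝ → ENNReal, Measurable g →
    ∫⁻ a, g (Complex.arg (p - a)) ∂(ProbabilityTheory.cond volume (Metric.closedBall p R)) =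
      K * ∫⁻ θ in Set.Ioo (-Real.pi) Real.pi, g θ := by
  refine ⟨(volume (Metric.closedBall p R))⁻¹ *
    ∫⁻ r in Set.Ioi (0 : ℝ), ENNReal.ofReal r * (Set.Iic R).indicator 1 r, fun g hg => ?_⟩
  rw [ProbabilityTheory.cond, lintegral_smul_measure, smul_eq_mul, mul_assoc]
  congr 1
  have h1 : ∫⁻ a in Metric.closedBall p R, g (Complex.arg (p - a)) =
      ∫⁻ z : ℂ, (Metric.closedBall (0 : ℂ) R).indicator (fun z => g (Complex.arg z)) z := by
    rw [← lintegral_indicator Metric.isClosed_closedBall.measurableSet,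
      ← lintegral_sub_left_eq_self _ p]
    refine lintegral_congr fun a => ?_
    simp only [Set.indicator, Metric.mem_closedBall, dist_eq_norm, sub_zero]
    rw [norm_sub_rev, sub_sub_cancel]
  rw [h1, ← Complex.lintegral_comp_polarCoord_symm, polarCoord_target,
    setLIntegral_congr_fun (g := fun q : ℝ × ℝ =>
      (ENNReal.ofReal q.1 * (Set.Iic R).indicator 1 q.1) * g q.2)
      (measurableSet_Ioi.prod measurableSet_Ioo)]
  · rw [Measure.volume_eq_prod, ← Measure.prod_restrict]
    have hm : Measurable fun r : ℝ => ENNReal.ofReal r * (Set.Iic R).indicator 1 r :=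
      ENNReal.measurable_ofReal.mul (measurable_one.indicator measurableSet_Iic)
    exact lintegral_prod_mul hm.aemeasurable hg.aemeasurable
  · rintro ⟨r, θ⟩ ⟨hr, hθ⟩
    have hr : 0 < r := hr
    have harg : Complex.arg (Complex.polarCoord.symm (r, θ)) = θ := by
      rw [Complex.polarCoord_symm_apply, Complex.ofReal_cos, Complex.ofReal_sin,
        Complex.arg_mul_cos_add_sin_mul_I hr ⟨hθ.1, hθ.2.le⟩]
    have hn : ‖Complex.polarCoord.symm (r, θ)‖ = r := by
      rw [Complex.norm_polarCoord_symm, abs_of_pos hr]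
    simp only [Set.indicator, Metric.mem_closedBall, dist_eq_norm, sub_zero, hn, harg,
      Set.mem_Iic, smul_eq_mul, Pi.one_apply]
    split_ifs <;> simp

lemma isProbabilityMeasure_cond_closedBall (p : ℂ) {R : ℝ} (hR : 0 < R) :
    IsProbabilityMeasure (ProbabilityTheory.cond volume (Metric.closedBall p R)) :=
  ProbabilityTheory.cond_isProbabilityMeasure_of_finite
    (Metric.measure_closedBall_pos _ _ hR).ne' measure_closedBall_lt_top.ne

lemma measurable_arg_sub (p : ℂ) : Measurable fun a : ℂ => Complex.arg (p - a) :=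
  Complex.measurable_arg.comp (measurable_const.sub measurable_id)

lemma map_arg_cond_closedBall (p : ℂ) {R : ℝ} (hR : 0 < R) :
    (ProbabilityTheory.cond volume (Metric.closedBall p R)).map (fun a => Complex.arg (p - a)) =
      (ENNReal.ofReal (2 * Real.pi))⁻¹ • volume.restrict (Set.Ioo (-Real.pi) Real.pi) := by
  have := isProbabilityMeasure_cond_closedBall p hR
  obtain ⟨K, hK⟩ := exists_lintegral_arg_eq p R
  have h1 := hK 1 measurable_one
  simp only [Pi.one_apply, lintegral_one, measure_univ, Measure.restrict_apply_univ,
    Real.volume_Ioo] at h1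
  rw [show Real.pi - -Real.pi = 2 * Real.pi by ring] at h1
  have hKe : K = (ENNReal.ofReal (2 * Real.pi))⁻¹ :=
    ENNReal.eq_inv_of_mul_eq_one_left h1.symm
  rw [← hKe]
  refine Measure.ext fun s hs => ?_
  have h2 := hK (s.indicator 1) (measurable_one.indicator hs)
  have h3 : ∀ a : ℂ, s.indicator (1 : ℝ → ENNReal) (Complex.arg (p - a)) =
      ((fun a : ℂ => Complex.arg (p - a)) ⁻¹' s).indicator 1 a := fun a => rfl
  simp_rw [h3] at h2
  rw [lintegral_indicator_one (measurable_arg_sub p hs), lintegral_indicator_one hs] at h2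
  rw [Measure.map_apply (measurable_arg_sub p) hs, h2]
  rfl

lemma map_doubleAngle_cond_closedBall (p : ℂ) {R : ℝ} (hR : 0 < R) :
    (ProbabilityTheory.cond volume (Metric.closedBall p R)).map
      (fun a => doubleAngle (angle a p)) = circleLaw := by
  rw [circleLaw, ← map_arg_cond_closedBall p hR,
    Measure.map_map continuous_doubleAngle.measurable (measurable_arg_sub p)]
  rfl

instance : IsProbabilityMeasure circleLaw := by
  have := isProbabilityMeasure_cond_closedBall 0 one_pos
  rw [← map_doubleAngle_cond_closedBall 0 one_pos]
  exact Measure.isProbabilityMeasure_map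
    (continuous_doubleAngle.measurable.comp (measurable_arg_sub 0)).aemeasurable

lemma circleLaw_ae_norm : ∀ᵐ z ∂circleLaw, ‖z‖ = 1 := by
  rw [circleLaw, ae_map_iff continuous_doubleAngle.aemeasurable
    (measurableSet_eq_fun measurable_norm measurable_const)]
  exact ae_of_all _ norm_doubleAngle

/-- A nonempty fibre lies in a translate of `πℤ`; hence `circleLaw` has no atoms. -/
lemma countable_doubleAngle_preimage (c : ℂ) : (doubleAngle ⁻¹' {c}).Countable := by
  rcases (doubleAngle ⁻¹' {c}).eq_empty_or_nonempty with h | ⟨θ₀, h0⟩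
  · rw [h]; exact Set.countable_empty
  · refine (Set.countable_range fun n : ℤ => θ₀ + n * Real.pi).mono ?_
    intro θ hθ
    have he : doubleAngle θ = doubleAngle θ₀ := by
      rw [Set.mem_preimage, Set.mem_singleton_iff] at hθ h0
      rw [hθ, h0]
    obtain ⟨n, hn⟩ := Complex.exp_eq_exp_iff_exists_int.1 he
    refine ⟨n, ?_⟩
    have := congrArg Complex.im hn
    simp at this
    simp only
    linarith

instance : NullSingletonClass circleLaw := by
  refine ⟨fun c => ?_⟩
  rw [circleLaw, Measure.map_apply continuous_doubleAngle.measurable (measurableSet_singleton c),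
    Measure.smul_apply, (countable_doubleAngle_preimage c).measure_zero, smul_zero]

/-! ### Characteristic functions of the random walk. -/

/-- Bessel's integral over a full period, for a vector `z` of arbitrary direction. -/
lemma integral_exp_im_mul (z : ℂ) :
    ∫ τ in (-Real.pi)..Real.pi,
      Complex.exp ((z * Complex.exp (τ * Complex.I)).im * Complex.I) =
      2 * Real.pi * besselJ 0 ‖z‖ := by
  set ρ := ‖z‖
  set σ := Complex.arg z
  have hz : z = ρ * Complex.exp (σ * Complex.I) := (Complex.norm_mul_exp_arg_mul_I z).symm
  let g : ℝ → ℂ := fun τ => Complex.exp ((ρ * Real.sin τ : ℝ) * Complex.I)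
  have hgc : Continuous g := by
    have : Continuous fun τ : ℝ => ρ * Real.sin τ := by fun_prop
    simp only [g]
    fun_prop
  have hper : Function.Periodic g (2 * Real.pi) := fun τ => by simp only [g, Real.sin_add_two_pi]
  have h1 : ∀ τ : ℝ, Complex.exp ((z * Complex.exp (τ * Complex.I)).im * Complex.I) =
      g (τ + σ) := by
    intro τ
    simp only [g]
    congr 3
    rw [hz, mul_assoc, ← Complex.exp_add, Complex.im_ofReal_mul, ← add_mul,
      ← Complex.ofReal_add, Complex.exp_ofReal_mul_I_im, add_comm]
  simp_rw [h1]
  rw [intervalIntegral.integral_comp_add_right]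
  have h2 : ∫ τ in (-Real.pi + σ)..(Real.pi + σ), g τ = ∫ τ in (-Real.pi)..Real.pi, g τ := by
    have := hper.intervalIntegral_add_eq (-Real.pi + σ) (-Real.pi)
    rwa [show -Real.pi + σ + 2 * Real.pi = Real.pi + σ by ring,
      show -Real.pi + 2 * Real.pi = Real.pi by ring] at this
  -- Folding the period at 0 pairs conjugate exponentials into a cosine.
  have h3 : ∫ τ in (-Real.pi)..0, g τ = ∫ τ in (0 : ℝ)..Real.pi, g (-τ) := by
    rw [intervalIntegral.integral_comp_neg, neg_zero]
  rw [h2, ← intervalIntegral.integral_add_adjacent_intervals (b := 0)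
    (hgc.intervalIntegrable _ _) (hgc.intervalIntegrable _ _), h3,
    ← intervalIntegral.integral_add
      (by exact (hgc.comp continuous_neg).intervalIntegrable _ _)
    (hgc.intervalIntegrable _ _)]
  have h4 : ∀ τ : ℝ, g (-τ) + g τ = ((2 * Real.cos (ρ * Real.sin τ) : ℝ) : ℂ) := by
    intro τ
    simp only [g, Real.sin_neg, mul_neg]
    push_cast
    rw [Complex.two_cos, add_comm]
  simp_rw [h4]
  rw [intervalIntegral.integral_ofReal, besselJ_zero_eq, intervalIntegral.integral_const_mul]
  push_cast
  have : (Real.pi : ℂ) ≠ 0 := by exact_mod_cast Real.pi_ne_zero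
  field_simp

lemma integral_exp_im_mul_circleLaw (z : ℂ) :
    ∫ v, Complex.exp ((z * v).im * Complex.I) ∂circleLaw = besselJ 0 ‖z‖ := by
  have hcont : Continuous fun v : ℂ => Complex.exp ((z * v).im * Complex.I) := by
    have : Continuous fun v : ℂ => (z * v).im := Complex.continuous_im.comp (by fun_prop)
    fun_prop
  let g : ℝ → ℂ := fun τ => Complex.exp ((z * Complex.exp (τ * Complex.I)).im * Complex.I)
  have hg : Continuous g := hcont.comp (by fun_prop : Continuous fun τ : ℝ =>
    Complex.exp (τ * Complex.I))
  have hper : Function.Periodic g (2 * Real.pi) := fun τ => by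
    simp only [g]
    congr 5
    push_cast
    rw [add_mul, Complex.exp_add, Complex.exp_two_pi_mul_I, mul_one]
  have hlt : -Real.pi ≤ Real.pi := by linarith [Real.pi_pos]
  rw [circleLaw, integral_map continuous_doubleAngle.aemeasurable
    hcont.aestronglyMeasurable, integral_smul_measure,
    ← integral_Ioc_eq_integral_Ioo, ← intervalIntegral.integral_of_le hlt]
  have h1 : ∀ θ : ℝ, Complex.exp ((z * doubleAngle θ).im * Complex.I) = g (2 * θ) := by
    intro θ
    simp only [g, doubleAngle]
    push_cast
    rfl
  simp_rw [h1]
  -- Doubling the angle covers two periods, and the Jacobian `1/2` compensates.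
  rw [intervalIntegral.integral_comp_mul_left g two_ne_zero,
    ← intervalIntegral.integral_add_adjacent_intervals (b := 0)
    (hg.intervalIntegrable _ _) (hg.intervalIntegrable _ _)]
  have e1 := hper.intervalIntegral_add_eq (2 * -Real.pi) (-Real.pi)
  have e2 := hper.intervalIntegral_add_eq 0 (-Real.pi)
  rw [show 2 * -Real.pi + 2 * Real.pi = 0 by ring,
    show -Real.pi + 2 * Real.pi = Real.pi by ring] at e1
  rw [zero_add, show -Real.pi + 2 * Real.pi = Real.pi by ring] at e2
  rw [e1, e2, integral_exp_im_mul, ENNReal.toReal_inv,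
    ENNReal.toReal_ofReal (by positivity)]
  have : (Real.pi : ℂ) ≠ 0 := by exact_mod_cast Real.pi_ne_zero
  simp only [Complex.real_smul]
  push_cast
  field_simp
  ring

/-- The joint law of `N` independent uniformly distributed unit vectors in the plane. -/
abbrev stepLaw (N : ℕ) : Measure (Fin N → ℂ) := Measure.pi fun _ => circleLaw

lemma measurable_norm_sum (N : ℕ) : Measurable fun v : Fin N → ℂ => ‖∑ i, v i‖ := by
  fun_prop

instance (a b : ℝ) : IsFiniteMeasure (volume.restrict (Set.uIoc a b)) :=
  ⟨by rw [Measure.restrict_apply_univ, Set.uIoc]; exact measure_Ioc_lt_top⟩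

/-- `J₀(r‖S‖)` is the mean over directions `τ` of a character evaluated at `S`. After exchanging the
integrals, independence factors each character into `J₀(r)^N`, whatever `τ` is. -/
lemma integral_besselJ_norm_sum (N : ℕ) {r : ℝ} (hr : 0 ≤ r) :
    ∫ v, besselJ 0 (r * ‖∑ i, v i‖) ∂stepLaw N = besselJ 0 r ^ N := by
  have hpi : (2 * Real.pi : ℂ) ≠ 0 := by
    simp [Real.pi_ne_zero]
  let F : ℝ → (Fin N → ℂ) → ℂ := fun τ v =>
    Complex.exp ((r * (∑ i, v i) * Complex.exp (τ * Complex.I)).im * Complex.I)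
  have hFc : Continuous (Function.uncurry F) := by
    have h : Continuous fun q : ℝ × (Fin N → ℂ) =>
        ((r * (∑ i, q.2 i) * Complex.exp (q.1 * Complex.I)).im) :=
      Complex.continuous_im.comp (by fun_prop)
    have : Continuous fun q : ℝ × (Fin N → ℂ) =>
        Complex.exp ((r * (∑ i, q.2 i) * Complex.exp (q.1 * Complex.I)).im * Complex.I) := by
      fun_prop
    exact this
  have hswap := intervalIntegral_integral_swap (μ := stepLaw N) (a := -Real.pi) (b := Real.pi)
    (f := F) (by
      refine Integrable.of_bound hFc.aestronglyMeasurable 1 (ae_of_all _ fun q => ?_)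
      simp only [Function.uncurry, F]
      rw [Complex.norm_exp_ofReal_mul_I])
  have hL : ∀ τ : ℝ, ∫ v, F τ v ∂stepLaw N = ((besselJ 0 r ^ N : ℝ) : ℂ) := by
    intro τ
    have h1 : ∀ v : Fin N → ℂ, F τ v =
        ∏ i, Complex.exp (((r * Complex.exp (τ * Complex.I)) * v i).im * Complex.I) := by
      intro v
      simp only [F]
      rw [← Complex.exp_sum, ← Finset.sum_mul, ← Complex.ofReal_sum, ← Complex.im_sum,
        ← Finset.mul_sum]
      congr 4
      ring
    simp_rw [h1]
    rw [integral_fintype_prod_eq_prod (fun (_ : Fin N) (z : ℂ) =>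
      Complex.exp (((r * Complex.exp (τ * Complex.I)) * z).im * Complex.I))]
    simp_rw [integral_exp_im_mul_circleLaw]
    rw [norm_mul, Complex.norm_exp_ofReal_mul_I, mul_one, Complex.norm_real, Real.norm_eq_abs,
      abs_of_nonneg hr]
    simp
  have hR : ∀ v : Fin N → ℂ, ∫ τ in (-Real.pi)..Real.pi, F τ v =
      2 * Real.pi * ((besselJ 0 (r * ‖∑ i, v i‖) : ℝ) : ℂ) := by
    intro v
    simp only [F]
    rw [integral_exp_im_mul, norm_mul, Complex.norm_real, Real.norm_eq_abs, abs_of_nonneg hr]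
  simp_rw [hL, hR] at hswap
  rw [intervalIntegral.integral_const, integral_const_mul, integral_complex_ofReal] at hswap
  have : ((besselJ 0 r ^ N : ℝ) : ℂ) =
      ((∫ v, besselJ 0 (r * ‖∑ i, v i‖) ∂stepLaw N : ℝ) : ℂ) := by
    apply mul_left_cancel₀ hpi
    rw [← hswap, Complex.real_smul]
    push_cast
    ring
  exact_mod_cast this.symm

/-! ### Absence of atoms. -/

lemma pi_eq_zero_of_ae_slice {α : Type*} [MeasurableSpace α] (μ : Measure α)
    [IsProbabilityMeasure μ] {n : ℕ} {s : Set (Fin (n + 1) → α)} (hs : MeasurableSet s)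
    (h : ∀ᵐ y ∂(Measure.pi fun _ : Fin n => μ), μ {x | Fin.cons x y ∈ s} = 0) :
    (Measure.pi fun _ : Fin (n + 1) => μ) s = 0 := by
  have hmp := measurePreserving_piFinSuccAbove (fun _ : Fin (n + 1) => μ) 0
  have hs' := (MeasurableEquiv.piFinSuccAbove (fun _ : Fin (n + 1) => α) 0).symm.measurable hs
  have h2 := hmp.symm.measure_preimage hs.nullMeasurableSet
  rw [← h2, Measure.prod_apply_symm hs', lintegral_eq_zero_iff (measurable_measure_prodMk_right hs')]
  filter_upwards [h] with y hy
  refine (measure_mono_null (fun x hx => ?_) hy)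
  simpa [MeasurableEquiv.piFinSuccAbove, Fin.insertNthEquiv] using hx

lemma stepLaw_sum_eq (n : ℕ) (c : ℂ) : stepLaw (n + 1) {v | ∑ i, v i = c} = 0 := by
  refine pi_eq_zero_of_ae_slice circleLaw
    (measurableSet_eq_fun (by fun_prop) measurable_const) (ae_of_all _ fun y => ?_)
  refine measure_mono_null (t := {c - ∑ i, y i}) (fun x hx => ?_) (measure_singleton _)
  simp only [Set.mem_ofPred_eq, Fin.sum_univ_succ, Fin.cons_zero, Fin.cons_succ] at hx
  exact eq_sub_of_add_eq hx

/-- Two circles with distinct centres meet in at most two points: the conditions determine the real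
part and the norm of `z * conj w`. -/
lemma countable_norm_one_norm_add_eq {w : ℂ} (hw : w ≠ 0) (U : ℝ) :
    {z : ℂ | ‖z‖ = 1 ∧ ‖z + w‖ = U}.Countable := by
  have hfin : Set.Finite {z : ℂ | ‖z‖ = 1 ∧ ‖z + w‖ = U} := by
    let c : ℝ := (U ^ 2 - 1 - ‖w‖ ^ 2) / 2
    let d : ℝ := Real.sqrt (‖w‖ ^ 2 - c ^ 2)
    have hcw : starRingEnd ℂ w ≠ 0 := (map_ne_zero _).2 hw
    refine (Set.toFinite {(⟨c, d⟩ : ℂ) / starRingEnd ℂ w, (⟨c, -d⟩ : ℂ) / starRingEnd ℂ w}).subset ?_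
    rintro z ⟨hz, hzw⟩
    have hre : (z * starRingEnd ℂ w).re = c := by
      have := Complex.normSq_add z w
      rw [Complex.normSq_eq_norm_sq, Complex.normSq_eq_norm_sq, Complex.normSq_eq_norm_sq, hz,
        hzw] at this
      simp only [c]
      linarith
    have him : (z * starRingEnd ℂ w).im ^ 2 = ‖w‖ ^ 2 - c ^ 2 := by
      have h1 : Complex.normSq (z * starRingEnd ℂ w) = ‖w‖ ^ 2 := by
        rw [Complex.normSq_mul, Complex.normSq_conj, Complex.normSq_eq_norm_sq,
          Complex.normSq_eq_norm_sq, hz]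
        ring
      rw [Complex.normSq_apply, hre] at h1
      linarith
    have hd : d ^ 2 = (z * starRingEnd ℂ w).im ^ 2 := by
      rw [him]
      exact Real.sq_sqrt (him ▸ sq_nonneg _)
    rw [Set.mem_insert_iff, Set.mem_singleton_iff, eq_div_iff hcw, eq_div_iff hcw]
    rcases sq_eq_sq_iff_eq_or_eq_neg.1 hd with h | h
    · exact Or.inl (Complex.ext hre h.symm)
    · exact Or.inr (Complex.ext hre (by simp [h]))
  exact hfin.countable

/-- The distance covered by at least two random steps has no atoms. -/
lemma stepLaw_norm_sum_eq (n : ℕ) (U : ℝ) : stepLaw (n + 2) {v | ‖∑ i, v i‖ = U} = 0 := by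
  -- If the other steps summed to 0, the two circles would be concentric and could coincide.
  have hae : ∀ᵐ y ∂stepLaw (n + 1), ∑ i, y i ≠ 0 := by
    rw [ae_iff]
    simpa using stepLaw_sum_eq n 0
  refine pi_eq_zero_of_ae_slice circleLaw
    (measurableSet_eq_fun (by fun_prop) measurable_const) ?_
  filter_upwards [hae] with y hy
  have hnull : circleLaw ({z : ℂ | ‖z‖ = 1 ∧ ‖z + ∑ i, y i‖ = U} ∪ {z | ¬ ‖z‖ = 1}) = 0 :=
    measure_union_null ((countable_norm_one_norm_add_eq hy U).measure_zero _)
      (ae_iff.1 circleLaw_ae_norm)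
  refine measure_mono_null (fun x hx => ?_) hnull
  simp only [Set.mem_ofPred_eq, Fin.sum_univ_succ (n := n + 1), Fin.cons_zero, Fin.cons_succ] at hx
  by_cases h1 : ‖x‖ = 1
  · exact Or.inl ⟨h1, hx⟩
  · exact Or.inr h1

lemma stepLaw_one_norm_sum_eq {U : ℝ} (hU : U ≠ 1) : stepLaw 1 {v | ‖∑ i, v i‖ = U} = 0 := by
  refine pi_eq_zero_of_ae_slice circleLaw
    (measurableSet_eq_fun (by fun_prop) measurable_const) (ae_of_all _ fun y => ?_)
  refine measure_mono_null (fun x hx => ?_) (ae_iff.1 circleLaw_ae_norm)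
  simp only [Set.mem_ofPred_eq, Fin.sum_univ_succ, Fin.cons_zero, Finset.univ_eq_empty,
    Finset.sum_empty, add_zero] at hx
  exact fun h1 => hU (hx.symm.trans h1)

/-- The bound on `U` matters only for a single step, whose length is almost surely 1. -/
lemma stepLaw_norm_sum_eq_of_lt {N : ℕ} (hN : 1 ≤ N) {U : ℝ} (hU : U < N) :
    stepLaw N {v | ‖∑ i, v i‖ = U} = 0 := by
  match N, hN, hU with
  | 1, _, hU => exact stepLaw_one_norm_sum_eq (by simpa using hU.ne)
  | n + 2, _, _ => exact stepLaw_norm_sum_eq n U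

/-! ### Kluyver's formula. -/

lemma integral_besselJ_mul_eq_weberIntegral {U : ℝ} (hU : 0 < U) (T σ : ℝ) :
    U * ∫ r in (0 : ℝ)..T, besselJ 1 (U * r) * besselJ 0 (r * σ) =
      weberIntegral (U * T) (σ / U) := by
  have := intervalIntegral.integral_comp_mul_left (a := 0) (b := T)
    (fun x => besselJ 1 x * besselJ 0 (σ / U * x)) hU.ne'
  rw [mul_zero, smul_eq_mul] at this
  rw [weberIntegral, ← mul_inv_cancel_left₀ hU.ne' (∫ x in (0 : ℝ)..(U * T), _), ← this]
  congr 1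
  refine intervalIntegral.integral_congr fun r _ => ?_
  congr 2
  field_simp

lemma integral_besselJ_mul_pow {U : ℝ} (hU : 0 < U) (N : ℕ) {T : ℝ} (hT : 0 ≤ T) :
    U * ∫ r in (0 : ℝ)..T, besselJ 1 (U * r) * besselJ 0 r ^ N =
      ∫ v, weberIntegral (U * T) (‖∑ i, v i‖ / U) ∂stepLaw N := by
  have hc : Continuous (Function.uncurry fun (r : ℝ) (v : Fin N → ℂ) =>
      besselJ 1 (U * r) * besselJ 0 (r * ‖∑ i, v i‖)) := by
    refine (continuous_besselJ_one_comp (f := fun q : ℝ × (Fin N → ℂ) => U * q.1) ?_).mul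
      (continuous_besselJ_zero_comp (f := fun q : ℝ × (Fin N → ℂ) => q.1 * ‖∑ i, q.2 i‖) ?_)
    all_goals fun_prop
  have hswap := intervalIntegral_integral_swap (μ := stepLaw N) (a := 0) (b := T)
    (f := fun r v => besselJ 1 (U * r) * besselJ 0 (r * ‖∑ i, v i‖)) (by
      refine Integrable.of_bound hc.aestronglyMeasurable 1 (ae_of_all _ fun q => ?_)
      simp only [Function.uncurry]
      rw [norm_mul]
      exact mul_le_one₀ (abs_besselJ_le_one _ _) (norm_nonneg _) (abs_besselJ_le_one _ _))
  simp_rw [← integral_besselJ_mul_eq_weberIntegral hU]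
  rw [integral_const_mul, ← hswap]
  congr 1
  refine intervalIntegral.integral_congr fun r hr => ?_
  rw [Set.uIcc_of_le hT] at hr
  rw [integral_const_mul, integral_besselJ_norm_sum N hr.1]

/-- Kluyver's formula for the distribution of the distance covered by a random walk in the
plane with unit steps. -/
theorem tendsto_integral_besselJ_mul_pow {N : ℕ} {U : ℝ} (hU : 0 < U)
    (hne : stepLaw N {v | ‖∑ i, v i‖ = U} = 0) :
    Tendsto (fun T : ℝ => U * ∫ r in (0 : ℝ)..T, besselJ 1 (U * r) * besselJ 0 r ^ N) atTop
      (𝓝 ((stepLaw N).real {v | ‖∑ i, v i‖ < U})) := by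
  have hmeas : MeasurableSet {v : Fin N → ℂ | ‖∑ i, v i‖ < U} :=
    measurableSet_lt (measurable_norm_sum N) measurable_const
  rw [← integral_indicator_one hmeas]
  have hcont : ∀ T : ℝ, 0 ≤ T → Continuous (weberIntegral T) := fun T hT =>
    continuous_iff_continuousAt.2 fun s => (hasDerivAt_weberIntegral hT s).continuousAt
  have hlim : Tendsto (fun T : ℝ => ∫ v, weberIntegral (U * T) (‖∑ i, v i‖ / U) ∂stepLaw N) atTop
      (𝓝 (∫ v, ({v : Fin N → ℂ | ‖∑ i, v i‖ < U}.indicator 1 v : ℝ) ∂stepLaw N)) := by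
    have hmul : Tendsto (fun T : ℝ => U * T) atTop atTop := tendsto_id.const_mul_atTop hU
    refine tendsto_integral_filter_of_dominated_convergence (fun _ => 31) ?_ ?_
      (integrable_const _) ?_
    · filter_upwards [eventually_ge_atTop 0] with T hT
      have := hcont (U * T) (by positivity)
      exact Continuous.aestronglyMeasurable (this.comp (by fun_prop))
    · filter_upwards [eventually_ge_atTop 0] with T hT
      exact ae_of_all _ fun v => abs_weberIntegral_le (by positivity) (by positivity)
    · have hae : ∀ᵐ v ∂stepLaw N, ‖∑ i, v i‖ ≠ U := by
        rw [ae_iff]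
        simpa using hne
      filter_upwards [hae] with v hv
      rcases lt_or_gt_of_ne hv with h | h
      · rw [Set.indicator_of_mem (by exact h)]
        exact (tendsto_weberIntegral_of_lt_one (by positivity) ((div_lt_one hU).2 h)).comp hmul
      · rw [Set.indicator_of_notMem (by simpa using h.le)]
        exact (tendsto_weberIntegral_of_one_lt ((one_lt_div hU).2 h)).comp hmul
  refine hlim.congr' ?_
  filter_upwards [eventually_ge_atTop 0] with T hT
  exact (integral_besselJ_mul_pow hU N hT).symm

lemma exists_tendsto_integral_besselJ {N : ℕ} {U : ℝ} (hU : 0 ≤ U)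
    (hne : stepLaw N {v | ‖∑ i, v i‖ = U} = 0) :
    ∃ I : ℝ, Tendsto (fun T : ℝ => ∫ r in (0 : ℝ)..T, besselJ 1 (U * r) * besselJ 0 r ^ N) atTop
      (𝓝 I) ∧ (stepLaw N).real {v | U < ‖∑ i, v i‖} = 1 - U * I := by
  have hcompl : (stepLaw N).real {v | U < ‖∑ i, v i‖} =
      1 - (stepLaw N).real {v | ‖∑ i, v i‖ < U} := by
    have hmeas : MeasurableSet {v : Fin N → ℂ | ‖∑ i, v i‖ < U} :=
      measurableSet_lt (measurable_norm_sum N) measurable_const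
    rw [← probReal_compl_eq_one_sub hmeas]
    refine measureReal_congr ?_
    have hae : ∀ᵐ v ∂stepLaw N, ‖∑ i, v i‖ ≠ U := by
      rw [ae_iff]
      simpa using hne
    filter_upwards [hae] with v hv
    refine propext ⟨fun h : U < _ => not_lt.2 h.le, fun h => ?_⟩
    exact lt_of_le_of_ne (not_lt.1 h) hv.symm
  -- For `U = 0` the integrand vanishes because `J₁(0) = 0`; this case avoids the division by `U`.
  rcases hU.eq_or_lt with h | h
  · refine ⟨0, ?_, ?_⟩
    · simp [← h, besselJ_one_zero]
    · rw [hcompl, ← h]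
      have : {v : Fin N → ℂ | ‖∑ i, v i‖ < 0} = ∅ :=
        Set.eq_empty_of_forall_notMem fun v hv => absurd (norm_nonneg _) (not_le.2 hv)
      simp [this]
  · refine ⟨(stepLaw N).real {v | ‖∑ i, v i‖ < U} / U, ?_, ?_⟩
    · have := (tendsto_integral_besselJ_mul_pow h hne).div_const U
      refine this.congr fun T => ?_
      rw [mul_div_cancel_left₀ _ h.ne']
    · rw [hcompl, mul_div_cancel₀ _ h.ne']

/-! ### The SPEB in terms of the resultant. -/

/-- The resultant of the doubled directions from the anchors to the position `q`. -/
def resultant {N : ℕ} (a : Fin N → ℂ) (q : ℂ) : ℂ := ∑ n, doubleAngle (angle (a n) q)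

lemma doubleAngle_re (θ : ℝ) : (doubleAngle θ).re = Real.cos θ ^ 2 - Real.sin θ ^ 2 := by
  have : (2 * θ * Complex.I : ℂ) = ((2 * θ : ℝ) : ℂ) * Complex.I := by push_cast; ring
  rw [doubleAngle, this, Complex.exp_ofReal_mul_I_re, Real.cos_two_mul']

lemma doubleAngle_im (θ : ℝ) : (doubleAngle θ).im = 2 * (Real.sin θ * Real.cos θ) := by
  have : (2 * θ * Complex.I : ℂ) = ((2 * θ : ℝ) : ℂ) * Complex.I := by push_cast; ring
  rw [doubleAngle, this, Complex.exp_ofReal_mul_I_im, Real.sin_two_mul, mul_assoc]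

lemma norm_resultant_le {N : ℕ} (a : Fin N → ℂ) (q : ℂ) : ‖resultant a q‖ ≤ N := by
  refine (norm_sum_le _ _).trans ?_
  simp [norm_doubleAngle]

lemma efim_apply {N : ℕ} (lam0 : ℝ) (a : Fin N → ℂ) (q : ℂ) (i j : Fin 2) :
    efim (fun _ => lam0) a q i j = lam0 * ∑ n, dirVec (a n) q i * dirVec (a n) q j := by
  simp [efim, Matrix.sum_apply, Matrix.vecMulVec_apply, Finset.mul_sum]

lemma efim_zero_zero_add_efim_one_one {N : ℕ} (lam0 : ℝ) (a : Fin N → ℂ) (q : ℂ) :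
    efim (fun _ => lam0) a q 0 0 + efim (fun _ => lam0) a q 1 1 = lam0 * N := by
  rw [efim_apply, efim_apply, ← mul_add, ← Finset.sum_add_distrib]
  simp [dirVec, ← sq]

lemma det_efim {N : ℕ} (lam0 : ℝ) (a : Fin N → ℂ) (q : ℂ) :
    (efim (fun _ => lam0) a q).det = lam0 ^ 2 / 4 * ((N : ℝ) ^ 2 - ‖resultant a q‖ ^ 2) := by
  have hsum := efim_zero_zero_add_efim_one_one lam0 a q
  have hre : lam0 * (resultant a q).re =
      efim (fun _ => lam0) a q 0 0 - efim (fun _ => lam0) a q 1 1 := by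
    rw [efim_apply, efim_apply, ← mul_sub, ← Finset.sum_sub_distrib, resultant, Complex.re_sum]
    simp [dirVec, doubleAngle_re, sq]
  have him : lam0 * (resultant a q).im = 2 * efim (fun _ => lam0) a q 0 1 := by
    rw [efim_apply, resultant, Complex.im_sum]
    simp [dirVec, doubleAngle_im, ← Finset.mul_sum, mul_comm (Real.sin _)]
    ring
  have hsymm : efim (fun _ => lam0) a q 1 0 = efim (fun _ => lam0) a q 0 1 := by
    rw [efim_apply, efim_apply]
    simp_rw [mul_comm]
  rw [Matrix.det_fin_two, hsymm, ← Complex.normSq_eq_norm_sq, Complex.normSq_apply]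
  have e1 : lam0 ^ 2 / 4 * ((N : ℝ) ^ 2 - ((resultant a q).re * (resultant a q).re +
      (resultant a q).im * (resultant a q).im)) = ((lam0 * N) ^ 2 -
      (lam0 * (resultant a q).re) ^ 2 - (lam0 * (resultant a q).im) ^ 2) / 4 := by ring
  rw [e1, ← hsum, hre, him]
  ring

/-- A 2×2 matrix and its adjugate have the same trace. In the singular case both sides are 0 by
convention. -/
lemma trace_inv_efim {N : ℕ} (lam0 : ℝ) (a : Fin N → ℂ) (q : ℂ) :
    (efim (fun _ => lam0) a q)⁻¹.trace = lam0 * N / (efim (fun _ => lam0) a q).det := by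
  rw [Matrix.inv_def, Matrix.trace_smul, Matrix.adjugate_fin_two, Matrix.trace_fin_two,
    ← efim_zero_zero_add_efim_one_one lam0 a q, Ring.inverse_eq_inv', smul_eq_mul]
  simp only [Matrix.of_apply, Matrix.cons_val', Matrix.cons_val_zero, Matrix.cons_val_one,
    Matrix.cons_val_fin_one]
  rw [div_eq_inv_mul, add_comm]

lemma lt_speb_iff {N : ℕ} (hN : 1 ≤ N) {lam0 eps : ℝ} (hlam0 : 0 < lam0) (heps : 0 < eps)
    (hreal : 0 ≤ (N : ℝ) ^ 2 - 4 * N / (lam0 * eps)) (a : Fin N → ℂ) (q : ℂ) :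
    (eps : EReal) < speb (fun _ => lam0) a q ↔
      Real.sqrt ((N : ℝ) ^ 2 - 4 * N / (lam0 * eps)) < ‖resultant a q‖ := by
  have hN0 : (0 : ℝ) < N := by exact_mod_cast hN
  have hle := norm_resultant_le a q
  rw [Real.sqrt_lt hreal (norm_nonneg _), speb]
  have hpos : 0 < 4 * N / (lam0 * eps) := by positivity
  split_ifs with h
  · have hnn : 0 ≤ (N : ℝ) ^ 2 - ‖resultant a q‖ ^ 2 := by
      nlinarith [norm_nonneg (resultant a q)]
    have hdet : 0 < (efim (fun _ => lam0) a q).det := by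
      refine lt_of_le_of_ne ?_ h.ne_zero.symm
      rw [det_efim]
      positivity
    rw [EReal.coe_lt_coe_iff, trace_inv_efim, lt_div_iff₀ hdet, det_efim, sub_lt_comm,
      lt_div_iff₀ (by positivity)]
    constructor
    · intro h1
      have : lam0 / 4 * (((N : ℝ) ^ 2 - ‖resultant a q‖ ^ 2) * (lam0 * eps)) <
          lam0 / 4 * (4 * N) := by linarith
      exact lt_of_mul_lt_mul_left this (by positivity)
    · intro h1
      have := mul_lt_mul_of_pos_left h1 (by positivity : 0 < lam0 / 4)
      linarith
  -- A singular matrix means that the resultant has the maximal norm `N`, which exceeds `U`, in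
  -- agreement with the value `⊤`.
  · refine iff_of_true (EReal.coe_lt_top _) ?_
    rw [isUnit_iff_ne_zero, not_not, det_efim] at h
    have : (N : ℝ) ^ 2 - ‖resultant a q‖ ^ 2 = 0 := by
      rcases mul_eq_zero.1 h with h | h
      · have : lam0 ^ 2 / 4 ≠ 0 := by positivity
        exact absurd h this
      · exact h
    linarith

/-! ### Transfer from the anchors to the random walk. -/

lemma map_anchorLaw (N : ℕ) (p : ℂ) {R : ℝ} (hR : 0 < R) :
    (anchorLaw N p R).map (fun a n => doubleAngle (angle (a n) p)) = stepLaw N := by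
  have := isProbabilityMeasure_cond_closedBall p hR
  have hm : Measurable fun a : ℂ => doubleAngle (angle a p) :=
    continuous_doubleAngle.measurable.comp (measurable_arg_sub p)
  have hs : SigmaFinite ((ProbabilityTheory.cond volume (Metric.closedBall p R)).map
      (fun a => doubleAngle (angle a p))) := by
    rw [map_doubleAngle_cond_closedBall p hR]; infer_instance
  rw [anchorLaw, Measure.pi_map_pi (f := fun _ a => doubleAngle (angle a p))
    (hμ := fun _ => hs) (fun _ => hm.aemeasurable)]
  simp_rw [map_doubleAngle_cond_closedBall p hR]

lemma measurable_resultant (N : ℕ) (p : ℂ) :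
    Measurable fun a : Fin N → ℂ => resultant a p := by
  have hm : Measurable fun a : ℂ => doubleAngle (angle a p) :=
    continuous_doubleAngle.measurable.comp (measurable_arg_sub p)
  exact Finset.measurable_sum _ fun n _ => hm.comp (measurable_pi_apply n)

lemma anchorLaw_norm_resultant_mem (N : ℕ) (p : ℂ) {R : ℝ} (hR : 0 < R) {s : Set ℝ}
    (hs : MeasurableSet s) :
    anchorLaw N p R {a | ‖resultant a p‖ ∈ s} = stepLaw N {v | ‖∑ i, v i‖ ∈ s} := by
  have hm : Measurable fun (a : Fin N → ℂ) n => doubleAngle (angle (a n) p) := by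
    refine measurable_pi_lambda _ fun n => ?_
    exact continuous_doubleAngle.measurable.comp
      ((measurable_arg_sub p).comp (measurable_pi_apply n))
  rw [← map_anchorLaw N p hR]
  exact (Measure.map_apply hm (measurable_norm_sum N hs)).symm

/-! ### The worst case over a small region. -/

/-- Normalising a vector costs a factor 2 and squaring the unit vector another 2. The case `x = 0`
is harmless, since `‖x‖ * exp (i arg x) = x` still holds. -/
lemma norm_doubleAngle_arg_sub_le (x : ℂ) {y : ℂ} (hy : y ≠ 0) :
    ‖doubleAngle (Complex.arg x) - doubleAngle (Complex.arg y)‖ ≤ 4 * (‖x - y‖ / ‖y‖) := by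
  set u := Complex.exp (Complex.arg x * Complex.I)
  set w := Complex.exp (Complex.arg y * Complex.I)
  have hu : ‖u‖ = 1 := Complex.norm_exp_ofReal_mul_I _
  have hw : ‖w‖ = 1 := Complex.norm_exp_ofReal_mul_I _
  have hx' : ‖x‖ * u = x := Complex.norm_mul_exp_arg_mul_I x
  have hy' : ‖y‖ * w = y := Complex.norm_mul_exp_arg_mul_I y
  have hpos : 0 < ‖y‖ := norm_pos_iff.2 hy
  have h2 : ∀ θ : ℝ, doubleAngle θ = Complex.exp (θ * Complex.I) ^ 2 := by
    intro θ
    rw [doubleAngle, ← Complex.exp_nat_mul]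
    congr 1
    push_cast
    ring
  have h1 : ‖u - w‖ ≤ 2 * (‖x - y‖ / ‖y‖) := by
    rw [← mul_div_assoc, le_div_iff₀ hpos]
    have e : (u - w) * ‖y‖ = ((‖y‖ - ‖x‖ : ℝ) : ℂ) * u + (x - y) := by
      rw [← hx', ← hy']
      simp only [norm_mul, hu, hw, Complex.norm_real, norm_norm, mul_one]
      push_cast
      ring
    calc ‖u - w‖ * ‖y‖ = ‖(u - w) * ‖y‖‖ := by rw [norm_mul, Complex.norm_real, norm_norm]
      _ ≤ ‖((‖y‖ - ‖x‖ : ℝ) : ℂ) * u‖ + ‖x - y‖ := by rw [e]; exact norm_add_le _ _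
      _ ≤ ‖x - y‖ + ‖x - y‖ := by
          rw [norm_mul, hu, mul_one, Complex.norm_real, norm_sub_rev x y]
          gcongr
          exact abs_norm_sub_norm_le _ _
      _ = 2 * ‖x - y‖ := by ring
  rw [h2, h2, sq_sub_sq, norm_mul]
  calc ‖u + w‖ * ‖u - w‖ ≤ 2 * (2 * (‖x - y‖ / ‖y‖)) := by
        gcongr
        exact (norm_add_le _ _).trans (by rw [hu, hw]; norm_num)
    _ = _ := by ring

/-- A displacement of `t ^ 2` seen from a distance beyond `t` is a relative displacement of at most
`t`, so one parameter controls both scales. -/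
lemma norm_resultant_sub_le {N : ℕ} {a : Fin N → ℂ} {p q : ℂ} {t : ℝ} (ht : 0 < t)
    (ha : ∀ n, t < ‖p - a n‖) (hq : ‖q - p‖ ≤ t ^ 2) :
    ‖resultant a q - resultant a p‖ ≤ 4 * N * t := by
  rw [resultant, resultant, ← Finset.sum_sub_distrib]
  refine (norm_sum_le_of_le (f := fun n => doubleAngle (angle (a n) q) -
    doubleAngle (angle (a n) p)) (n := fun _ => 4 * t) _ fun n _ => ?_).trans ?_
  · have hpos : 0 < ‖p - a n‖ := ht.trans (ha n)
    refine (norm_doubleAngle_arg_sub_le (q - a n) (norm_pos_iff.1 hpos)).trans ?_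
    rw [sub_sub_sub_cancel_right]
    gcongr
    rw [div_le_iff₀ hpos]
    nlinarith [ha n]
  · simp only [Finset.sum_const, Finset.card_univ, Fintype.card_fin, nsmul_eq_mul]
    apply le_of_eq
    ring

/-- The anchor positions for which a displacement of the agent by at most `t ^ 2` may raise the
norm of the resultant above `U`. -/
def sensitiveSet {N : ℕ} (p : ℂ) (U t : ℝ) : Set (Fin N → ℂ) :=
  {a | ∃ n, ‖p - a n‖ ≤ t} ∪ {a | U - 4 * N * t < ‖resultant a p‖}

lemma measurableSet_sensitiveSet {N : ℕ} (p : ℂ) (U t : ℝ) :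
    MeasurableSet (sensitiveSet p U t : Set (Fin N → ℂ)) := by
  refine MeasurableSet.union ?_ (measurableSet_lt measurable_const (measurable_resultant N p).norm)
  rw [Set.ofPred_exists]
  exact MeasurableSet.iUnion fun n => measurableSet_le (by fun_prop) measurable_const

lemma sensitiveSet_mono {N : ℕ} (p : ℂ) (U : ℝ) :
    Monotone (sensitiveSet p U : ℝ → Set (Fin N → ℂ)) := by
  intro s t hst
  refine Set.union_subset_union (fun a ⟨n, hn⟩ => ⟨n, hn.trans hst⟩) (fun a ha => ?_)
  refine lt_of_le_of_lt (?_ : U - 4 * N * t ≤ U - 4 * N * s) ha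
  gcongr

lemma mem_sensitiveSet {N : ℕ} {a : Fin N → ℂ} {p q : ℂ} {U t : ℝ} (ht : 0 < t)
    (hq : ‖q - p‖ ≤ t ^ 2) (h : U < ‖resultant a q‖) : a ∈ sensitiveSet p U t := by
  by_cases ha : ∃ n, ‖p - a n‖ ≤ t
  · exact Or.inl ha
  · push Not at ha
    have h1 := norm_resultant_sub_le ht ha hq
    have h2 := norm_sub_norm_le (resultant a q) (resultant a p)
    exact Or.inr (show U - 4 * N * t < ‖resultant a p‖ by linarith)

/-- The first two sets on the right will be null: an anchor exactly at `p`, and a resultant exactly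
on the threshold. -/
lemma iInter_sensitiveSet_subset {N : ℕ} (p : ℂ) (U : ℝ) :
    ⋂ k : ℕ, (sensitiveSet p U (1 / ((k : ℝ) + 1)) : Set (Fin N → ℂ)) ⊆
      (⋃ n, {a | a n = p}) ∪ {a | ‖resultant a p‖ = U} ∪ {a | U < ‖resultant a p‖} := by
  intro a ha
  by_cases hp : ∃ n, a n = p
  · exact Or.inl (Or.inl (Set.mem_iUnion.2 hp))
  · push Not at hp
    have hU : U ≤ ‖resultant a p‖ := by
      have h1 : Tendsto (fun k : ℕ => 1 / ((k : ℝ) + 1)) atTop (𝓝 0) :=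
        tendsto_one_div_add_atTop_nhds_zero_nat
      have hev : ∀ᶠ k : ℕ in atTop, ∀ n, 1 / ((k : ℝ) + 1) < ‖p - a n‖ :=
        eventually_all.2 fun n =>
          h1.eventually_lt_const (norm_pos_iff.2 (sub_ne_zero.2 (hp n).symm))
      have h2 : Tendsto (fun k : ℕ => U - 4 * N * (1 / ((k : ℝ) + 1))) atTop (𝓝 U) := by
        simpa using (h1.const_mul (4 * N : ℝ)).const_sub U
      refine le_of_tendsto h2 ?_
      filter_upwards [hev] with k hk
      rcases Set.mem_iInter.1 ha k with ⟨n, hn⟩ | h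
      · exact absurd hn (not_le.2 (hk n))
      · exact le_of_lt h
    rcases hU.eq_or_lt with h | h
    · exact Or.inl (Or.inr h.symm)
    · exact Or.inr h

instance (N : ℕ) (p : ℂ) (R : ℝ) : IsFiniteMeasure (anchorLaw N p R) := by
  unfold anchorLaw; infer_instance

lemma anchorLaw_eq_zero (N : ℕ) (p c : ℂ) (R : ℝ) (n : Fin N) :
    anchorLaw N p R {a | a n = c} = 0 := by
  have : NullSingletonClass (ProbabilityTheory.cond (volume : Measure ℂ)
      (Metric.closedBall p R)) :=
    ⟨fun x => ProbabilityTheory.cond_absolutelyContinuous (measure_singleton x)⟩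
  exact Measure.pi_hyperplane (α := fun _ : Fin N => ℂ) _ n c

lemma exists_anchorLaw_sensitiveSet_lt {N : ℕ} (p : ℂ) {U R : ℝ}
    (hne : anchorLaw N p R {a | ‖resultant a p‖ = U} = 0) {δ : ℝ} (hδ : 0 < δ) :
    ∃ t > 0, (anchorLaw N p R).real (sensitiveSet p U t) <
      (anchorLaw N p R).real {a | U < ‖resultant a p‖} + δ := by
  have hanti : Antitone fun k : ℕ => (sensitiveSet p U (1 / ((k : ℝ) + 1)) : Set (Fin N → ℂ)) :=
    fun i j hij => sensitiveSet_mono p U (one_div_le_one_div_of_le (by positivity) (by gcongr))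
  have hlim := tendsto_measure_iInter_atTop (μ := anchorLaw N p R)
    (fun k => (measurableSet_sensitiveSet p U _).nullMeasurableSet) hanti
    ⟨0, measure_ne_top _ _⟩
  have hle : anchorLaw N p R (⋂ k : ℕ, sensitiveSet p U (1 / ((k : ℝ) + 1))) ≤
      anchorLaw N p R {a | U < ‖resultant a p‖} := by
    refine (measure_mono (iInter_sensitiveSet_subset p U)).trans ?_
    refine (measure_union_le _ _).trans ?_
    rw [measure_union_null (measure_iUnion_null fun n => anchorLaw_eq_zero N p p R n) hne, zero_add]
  have hlim' := (ENNReal.tendsto_toReal (measure_ne_top _ _)).comp hlim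
  have hlt : (anchorLaw N p R (⋂ k : ℕ, sensitiveSet p U (1 / ((k : ℝ) + 1)))).toReal <
      (anchorLaw N p R).real {a | U < ‖resultant a p‖} + δ :=
    lt_of_le_of_lt (ENNReal.toReal_mono (measure_ne_top _ _) hle) (lt_add_of_pos_right _ hδ)
  obtain ⟨k, hk⟩ := (hlim'.eventually_lt_const hlt).exists
  exact ⟨1 / ((k : ℝ) + 1), by positivity, hk⟩

theorem exists_abs_worstOutage_sub_outageAt_lt {N : ℕ} {lam0 eps R U : ℝ} {p : ℂ}
    (hiff : ∀ (a : Fin N → ℂ) (q : ℂ),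
      (eps : EReal) < speb (fun _ => lam0) a q ↔ U < ‖resultant a q‖)
    (hne : anchorLaw N p R {a | ‖resultant a p‖ = U} = 0) {δ : ℝ} (hδ : 0 < δ) :
    ∃ ρ > 0, ∀ (pstar : ℂ) (r : ℝ), r ≤ ρ → p ∈ Metric.closedBall pstar r →
      |worstOutage N lam0 eps R p pstar r - outageAt N lam0 eps R p| < δ := by
  obtain ⟨t, ht, hlt⟩ := exists_anchorLaw_sensitiveSet_lt p hne hδ
  -- The disc need not be centred at `p`: two of its points are at most a diameter, hence `t ^ 2`,
  -- apart.
  refine ⟨t ^ 2 / 2, by positivity, fun pstar r hr hp => ?_⟩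
  have hout : outageAt N lam0 eps R p = (anchorLaw N p R).real {a | U < ‖resultant a p‖} := by
    simp_rw [outageAt, hiff]
  have hlow : outageAt N lam0 eps R p ≤ worstOutage N lam0 eps R p pstar r :=
    measureReal_mono (fun a ha => lt_of_lt_of_le ha
      (le_iSup₂_of_le (f := fun q (_ : q ∈ Metric.closedBall pstar r) =>
        speb (fun _ => lam0) a q) p hp le_rfl))
  have hup : worstOutage N lam0 eps R p pstar r ≤ (anchorLaw N p R).real (sensitiveSet p U t) := by
    refine measureReal_mono fun a ha => ?_
    obtain ⟨q, hq⟩ := lt_iSup_iff.1 (show (eps : EReal) < ⨆ q, _ from ha)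
    obtain ⟨hqm, hq⟩ := lt_iSup_iff.1 hq
    refine mem_sensitiveSet ht ?_ ((hiff a q).1 hq)
    rw [← dist_eq_norm]
    have h1 := dist_triangle_right q p pstar
    rw [Metric.mem_closedBall] at hqm hp
    linarith
  rw [abs_lt]
  constructor <;> linarith

end Localization

end

theorem theorem1 (N : ℕ) (hN : 1 ≤ N) (lam0 eps R U : ℝ) (p : ℂ)
    (hlam0 : 0 < lam0) (heps : 0 < eps) (hR : 0 < R)
    (hreal : 0 ≤ (N : ℝ) ^ 2 - 4 * N / (lam0 * eps))
    (hU : U = Real.sqrt ((N : ℝ) ^ 2 - 4 * N / (lam0 * eps))) :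
    ∃ I : ℝ,
      Tendsto (fun T : ℝ => ∫ r in (0 : ℝ)..T,
          Localization.besselJ 1 (U * r) * Localization.besselJ 0 r ^ N) atTop (𝓝 I) ∧
      Localization.outageAt N lam0 eps R p = 1 - U * I ∧
      ∀ δ > 0, ∃ ρ > 0, ∀ (pstar : ℂ) (r : ℝ), r ≤ ρ → p ∈ Metric.closedBall pstar r →
        |Localization.worstOutage N lam0 eps R p pstar r - (1 - U * I)| < δ := by
  have hN0 : (0 : ℝ) < N := by exact_mod_cast hN
  have hiff : ∀ (a : Fin N → ℂ) (q : ℂ), (eps : EReal) < Localization.speb (fun _ => lam0) a q ↔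
      U < ‖Localization.resultant a q‖ := fun a q => by
    rw [hU]; exact Localization.lt_speb_iff hN hlam0 heps hreal a q
  have hU0 : 0 ≤ U := hU ▸ Real.sqrt_nonneg _
  have hUN : U < N := by
    rw [hU, Real.sqrt_lt hreal hN0.le]
    have : 0 < 4 * N / (lam0 * eps) := by positivity
    linarith
  -- This serves twice: for the limit in Kluyver's formula, and for the continuity of the outage
  -- probability under small displacements.
  have hne := Localization.stepLaw_norm_sum_eq_of_lt hN hUN
  obtain ⟨I, hI, hP⟩ := Localization.exists_tendsto_integral_besselJ hU0 hne
  have hout : Localization.outageAt N lam0 eps R p = 1 - U * I := by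
    rw [← hP]
    simp_rw [Localization.outageAt, hiff]
    exact congrArg ENNReal.toReal
      (Localization.anchorLaw_norm_resultant_mem N p hR (measurableSet_Ioi (a := U)))
  refine ⟨I, hI, hout, fun δ hδ => ?_⟩
  rw [← hout]
  exact Localization.exists_abs_worstOutage_sub_outageAt_lt hiff
    ((Localization.anchorLaw_norm_resultant_mem N p hR (measurableSet_singleton U)).trans hne) hδ
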